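/- Let $(\mathbb D,<)$ be an infinite linearly ordered set. A data word over a finite alphabet $\mathbb A$ is a nonempty finite word $w=(a_1,d_1)\cdots(a_n,d_n)$ over $\mathbb A\times\mathbb D$; position $i$ has type $\rhd$ if $i<n$ and $\bar\rhd$ if $i=n$. An automaton of $\mathsf{ARA}(\mathsf{guess},\mathsf{spread},<)$ is a tuple $\mathcal A=\langle\mathbb A,Q,q_I,\delta\rangle$ with a finite alphabet $\mathbb A$, a finite set of states $Q$, an initial state $q_I\in Q$, and a function $\delta$ that assigns to each state an instruction of one of the forms $$a,\quad \bar a,\quad \odot?,\quad \mathsf{store}(q),\quad \mathsf{test}(\bowtie),\quad q\land q',\quad q\lor q',\quad \rhd q,\quad \mathsf{guess}(q),\quad \mathsf{spread}(q,q')$$ where $a\in\mathbb A$, $q,q'\in Q$, $\odot\in\{\rhd,\bar\rhd\}$ and ${\bowtie}\in\{<,>,=,\neq\}$. A state $q$ is moving if $\delta(q)=\rhd q'$ for some $q'$. A configuration $\langle i,\alpha,(a,d),\Delta\rangle$ consists of a position $i$, a type $\alpha$, a letter $a$, a datum $d$, and a finite set $\Delta\subseteq Q\times\mathbb D$ of threads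 (state, register value). The relation $\rightarrowtail$ between configurations is the union of the following. * Non-moving steps: $\langle i,\alpha,(a,d),\{(q,d')\}\cup\Delta\rangle\rightarrow_\varepsilon\langle i,\alpha,(a,d),\Delta'\rangle$, where - $\Delta'=\{(q_j,d')\}\cup\Delta$ with $j\in\{1,2\}$ if $\delta(q)=q_1\lor q_2$; - $\Delta'=\{(q_1,d'),(q_2,d')\}\cup\Delta$ if $\delta(q)=q_1\land q_2$; - $\Delta'=\{(q',d)\}\cup\Delta$ if $\delta(q)=\mathsf{store}(q')$; - $\Delta'=\{(q',e)\}\cup\Delta$ for any $e\in\mathbb D$ if $\delta(q)=\mathsf{guess}(q')$; - $\Delta'=\Delta$ if $\delta(q)=\mathsf{test}(\bowtie)$ and $d\bowtie d'$, or $\delta(q)=\alpha?$, or $\delta(q)=a$, or $\delta(q)=\bar b$ with $b\neq a$; - $\Delta'=\{(q_1,e)\mid(q_2,e)\in\Delta\}\cup\Delta$ if $\delta(q)=\mathsf{spread}(q_2,q_1)$ and, for every $(\tilde q,\tilde d)\in\Delta$, $\delta(\tilde q)$ is a $\mathsf{spread}$ instruction or $\tilde q$ is moving. * Moving steps: $\langle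 i,\rhd,\gamma,\Delta\rangle\rightarrow_{\rhd}\langle i+1,\alpha',\gamma',\Delta'\rangle$ for any type $\alpha'$ and any $\gamma'\in\mathbb A\times\mathbb D$, if every state occurring in $\Delta$ is moving and $\Delta'=\{(q',e)\mid(q,e)\in\Delta,\ \delta(q)=\rhd q'\}$. A run of $\mathcal A$ over $w$ is a nonempty finite sequence $C_1\rightarrowtail\cdots\rightarrowtail C_k$ of configurations such that $C_1$ has position $1$ and thread set $\{(q_I,d_1)\}$, and in every $C_j=\langle i,\alpha,\gamma,\Delta\rangle$, $i$ is a position of $w$, $\gamma=w(i)$, and $\alpha$ is the type of $i$ in $w$. It is accepting if the thread set of $C_k$ is empty. $L(\mathcal A)$ is the set of data words over which $\mathcal A$ has an accepting run. Theorem. The emptiness problem for $\mathsf{ARA}(\mathsf{guess},\mathsf{spread},<)$ is decidable: the set of (standard finite codes of) automata $\mathcal A$ with $L(\mathcal A)=\emptyset$ is computable. -/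

import Mathlib

namespace AltReg

/-- A data word over the alphabet `A` and the data domain `D`: a nonempty finite sequence of pairs
(letter, data value). Positions are numbered from `0`. -/
abbrev DataWord (A D : Type*) := {w : List (A × D) // w ≠ []}

/-- The type of a position: `hasNext` (written `▷`) if there is a next position,
`isLast` (written `▷` with a bar) otherwise. -/
inductive PosType
  | hasNext
  | isLast
  deriving DecidableEq

/-- The type of position `i` in the data word `w`. -/
def DataWord.posType {A D : Type*} (w : DataWord A D) (i : ℕ) : PosType :=
  if i + 1 < w.1.length then PosType.hasNext else PosType.isLast

/-- The four tests `test(<)`, `test(>)`, `test(=)`, `test(≠)`. -/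
inductive DataTest
  | lt
  | gt
  | eq
  | ne
  deriving DecidableEq

/-- `t.Holds d d'`: the datum `d` of the current position is in relation `t` to the datum `d'`
stored in the register. -/
def DataTest.Holds {D : Type*} [LinearOrder D] : DataTest → D → D → Prop
  | .lt, d, d' => d < d'
  | .gt, d, d' => d > d'
  | .eq, d, d' => d = d'
  | .ne, d, d' => d ≠ d'

/-- The right-hand sides of transitions, over letters `A` and states `Q`. -/
inductive Instr (A Q : Type*)
  /-- `a`: the current letter is `a` -/
  | letter (a : A)
  /-- `a` with a bar: the current letter is not `a` -/
  | notLetter (a : A)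
  /-- `▷?` or its barred version: the type of the current position is `t` -/
  | isType (t : PosType)
  | store (q : Q)
  | test (t : DataTest)
  | and (q q' : Q)
  | or (q q' : Q)
  /-- `▷ q`: move to the next position -/
  | move (q : Q)
  | guess (q : Q)
  | spread (q q' : Q)

/-- An alternating register automaton of `ARA(guess, spread, <)` with alphabet `A` and set of
states `Q`. -/
structure ARA (A Q : Type*) where
  init : Q
  δ : Q → Instr A Q

/-- A configuration: position, type, letter and datum of the position, and a finite set of threads
(pairs of a state and the value of the register). -/
structure Config (A Q D : Type*) where
  pos : ℕ
  type : PosType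
  label : A × D
  threads : Finset (Q × D)

namespace ARA

variable {A Q D : Type*}

/-- The state `q` is moving. -/
def Moving (𝒜 : ARA A Q) (q : Q) : Prop := ∃ q', 𝒜.δ q = .move q'

/-- The instruction of the state `q` is a `spread`. -/
def Spreading (𝒜 : ARA A Q) (q : Q) : Prop := ∃ q₂ q₁, 𝒜.δ q = .spread q₂ q₁

variable [DecidableEq Q] [LinearOrder D]

/-- The non-moving transition relation `→_ε`. In each clause the source has the threads
`{(q, d')} ∪ Δ`, and the instruction of `q` is executed for the thread `(q, d')`. -/
inductive StepEps (𝒜 : ARA A Q) : Config A Q D → Config A Q D → Prop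
  | orLeft {i α a d q d' Δ q₁ q₂} (h : 𝒜.δ q = .or q₁ q₂) :
      StepEps 𝒜 ⟨i, α, (a, d), insert (q, d') Δ⟩ ⟨i, α, (a, d), insert (q₁, d') Δ⟩
  | orRight {i α a d q d' Δ q₁ q₂} (h : 𝒜.δ q = .or q₁ q₂) :
      StepEps 𝒜 ⟨i, α, (a, d), insert (q, d') Δ⟩ ⟨i, α, (a, d), insert (q₂, d') Δ⟩
  | and {i α a d q d' Δ q₁ q₂} (h : 𝒜.δ q = .and q₁ q₂) :
      StepEps 𝒜 ⟨i, α, (a, d), insert (q, d') Δ⟩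
        ⟨i, α, (a, d), insert (q₁, d') (insert (q₂, d') Δ)⟩
  | store {i α a d q d' Δ q'} (h : 𝒜.δ q = .store q') :
      StepEps 𝒜 ⟨i, α, (a, d), insert (q, d') Δ⟩ ⟨i, α, (a, d), insert (q', d) Δ⟩
  | test {i α a d q d' Δ t} (h : 𝒜.δ q = .test t) (ht : t.Holds d d') :
      StepEps 𝒜 ⟨i, α, (a, d), insert (q, d') Δ⟩ ⟨i, α, (a, d), Δ⟩
  | isType {i α a d q d' Δ} (h : 𝒜.δ q = .isType α) :
      StepEps 𝒜 ⟨i, α, (a, d), insert (q, d') Δ⟩ ⟨i, α, (a, d), Δ⟩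
  | letter {i α a d q d' Δ} (h : 𝒜.δ q = .letter a) :
      StepEps 𝒜 ⟨i, α, (a, d), insert (q, d') Δ⟩ ⟨i, α, (a, d), Δ⟩
  | notLetter {i α a d q d' Δ b} (h : 𝒜.δ q = .notLetter b) (hb : b ≠ a) :
      StepEps 𝒜 ⟨i, α, (a, d), insert (q, d') Δ⟩ ⟨i, α, (a, d), Δ⟩
  | guess {i α a d q d' Δ q'} (h : 𝒜.δ q = .guess q') (e : D) :
      StepEps 𝒜 ⟨i, α, (a, d), insert (q, d') Δ⟩ ⟨i, α, (a, d), insert (q', e) Δ⟩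
  | spread {i α a d q d' Δ q₂ q₁} (h : 𝒜.δ q = .spread q₂ q₁)
      (hΔ : ∀ p ∈ Δ, 𝒜.Spreading p.1 ∨ 𝒜.Moving p.1) :
      StepEps 𝒜 ⟨i, α, (a, d), insert (q, d') Δ⟩
        ⟨i, α, (a, d), (Δ.filter (fun p => p.1 = q₂)).image (fun p => (q₁, p.2)) ∪ Δ⟩

/-- The moving transition relation `→_▷`: all threads advance simultaneously. -/
inductive StepMove (𝒜 : ARA A Q) : Config A Q D → Config A Q D → Prop
  | move {i γ Δ α' γ' Δ'} (hΔ : ∀ p ∈ Δ, 𝒜.Moving p.1)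
      (hΔ' : ∀ q' d, (q', d) ∈ Δ' ↔ ∃ q, (q, d) ∈ Δ ∧ 𝒜.δ q = .move q') :
      StepMove 𝒜 ⟨i, .hasNext, γ, Δ⟩ ⟨i + 1, α', γ', Δ'⟩

/-- The transition relation between configurations: the union of `→_▷` and `→_ε`. -/
def Step (𝒜 : ARA A Q) (ρ τ : Config A Q D) : Prop :=
  𝒜.StepMove ρ τ ∨ 𝒜.StepEps ρ τ

/-- The nonempty sequence `r` of configurations is a run of `𝒜` over the data word `w`. -/
structure IsRun (𝒜 : ARA A Q) (w : DataWord A D) (r : List (Config A Q D)) : Prop where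
  ne_nil : r ≠ []
  chain : r.IsChain 𝒜.Step
  head_pos : (r.head ne_nil).pos = 0
  head_threads : (r.head ne_nil).threads = {(𝒜.init, (w.1.head w.2).2)}
  label_eq : ∀ ρ ∈ r, w.1[ρ.pos]? = some ρ.label
  type_eq : ∀ ρ ∈ r, ρ.type = w.posType ρ.pos

/-- The data word `w` is accepted: some run over `w` ends in a configuration without threads. -/
def Accepts (𝒜 : ARA A Q) (w : DataWord A D) : Prop :=
  ∃ (r : List (Config A Q D)) (h : 𝒜.IsRun w r), (r.getLast h.ne_nil).threads = ∅

/-- The language of `𝒜`: the set of accepted data words over the data domain `D`. -/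
def language (𝒜 : ARA A Q) (D : Type*) [LinearOrder D] : Set (DataWord A D) :=
  {w | 𝒜.Accepts w}

end ARA

/-- The position type as a number, for use in codes. -/
def PosType.code : PosType → ℕ
  | .hasNext => 0
  | .isLast => 1

/-- The data test as a number, for use in codes. -/
def DataTest.code : DataTest → ℕ
  | .lt => 0
  | .gt => 1
  | .eq => 2
  | .ne => 3

/-- An instruction as a triple of numbers: a tag and up to two arguments. -/
def Instr.code {n m : ℕ} : Instr (Fin n) (Fin m) → ℕ × ℕ × ℕ
  | .letter a => (0, a, 0)
  | .notLetter a => (1, a, 0)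
  | .isType t => (2, t.code, 0)
  | .store q => (3, q, 0)
  | .test t => (4, t.code, 0)
  | .and q q' => (5, q, q')
  | .or q q' => (6, q, q')
  | .move q => (7, q, 0)
  | .guess q => (8, q, 0)
  | .spread q q' => (9, q, q')

/-- Finite descriptions of automata: number of letters, number of states, initial state, and
the table of the transition function. -/
abbrev ARACode := ℕ × ℕ × ℕ × List (ℕ × ℕ × ℕ)

/-- The description of an automaton with letters `0, …, n - 1` and states `0, …, m - 1`. -/
def ARA.code {n m : ℕ} (𝒜 : ARA (Fin n) (Fin m)) : ARACode :=
  (n, m, 𝒜.init, List.ofFn fun q => (𝒜.δ q).code)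

/-- Distinct instructions have distinct codes. -/
theorem Instr.code_injective {n m : ℕ} :
    Function.Injective (Instr.code : Instr (Fin n) (Fin m) → ℕ × ℕ × ℕ) := by
  intro x y h
  rcases x with a | a | (_ | _) | q | (_ | _ | _ | _) | ⟨q, q'⟩ | ⟨q, q'⟩ | q | q | ⟨q, q'⟩ <;>
    rcases y with b | b | (_ | _) | p | (_ | _ | _ | _) | ⟨p, p'⟩ | ⟨p, p'⟩ | p | p | ⟨p, p'⟩ <;>
    simp_all [Instr.code, PosType.code, DataTest.code, Fin.ext_iff]

/-- Distinct automata have distinct codes. -/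
theorem ARA.code_injective {n m : ℕ} :
    Function.Injective (ARA.code : ARA (Fin n) (Fin m) → ARACode) := by
  rintro ⟨i, δ⟩ ⟨i', δ'⟩ h
  simp only [ARA.code, Prod.mk.injEq, true_and, Fin.val_inj, List.ofFn_inj] at h
  obtain ⟨rfl, h⟩ := h
  congr 1
  funext q
  exact Instr.code_injective (congrFun h q)

end AltReg

namespace AltReg

open Relation Primrec

/-! Emptiness and nonemptiness are both shown to be recursively enumerable on valid codes, where
validity is a primitive recursive condition; Post's theorem then gives decidability.

An accepting run compares only finitely many data, so it can be moved into any other infinite linear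
order (`RawNonempty.transfer`). Hence `D` may be replaced by `ℕ`, whose elements can be enumerated,
and by `ℚ`, in which finite monotone maps extend to automorphisms. A run also determines the word
that it reads, so acceptance becomes reachability of a configuration without threads
(`language_eq_empty_iff`). Nonemptiness is then found by enumerating finite runs over `ℕ`.

For emptiness, order the configurations over `ℚ` by inclusion of threads up to an automorphism. Two
facts carry the argument. A smaller configuration answers each step of a larger one by a step or by
waiting (`RawLE.step`), since dropping threads only removes obligations. The order is a
well-quasi-order on configurations with boundedly many letters and states
(`partiallyWellOrderedOn_rawLE`): a configuration is a word over a finite alphabet, with one letter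
for each datum in increasing order, and Higman's lemma applies.

So the reachable configurations have a finite basis. If none of them is accepting, this basis
certifies emptiness: each initial configuration and each successor of a basis element lies above a
basis element. Conversely, such a certificate is an invariant that excludes accepting runs. It is
checked by a finite computation: with the data of the basis stored as odd naturals, each new
rational datum is equivalent to an old value or to an even number in a gap (`exists_nat_position`).
-/

/-! ### Extension and embedding of finite orders -/

/-- A finite strictly monotone relation on `ℚ` extends to an order automorphism. -/
theorem exists_orderIso_extending (s : Finset (ℚ × ℚ))
    (hs : ∀ p ∈ s, ∀ q ∈ s, p.1 < q.1 ↔ p.2 < q.2) :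
    ∃ π : ℚ ≃o ℚ, ∀ p ∈ s, π p.1 = p.2 := by
  classical
  have hcmp : ∀ p ∈ s, ∀ q ∈ s, cmp p.1 q.1 = cmp p.2 q.2 := by
    intro p hp q hq
    rcases lt_trichotomy p.1 q.1 with h | h | h
    · rw [cmp_eq_lt_iff _ _ |>.2 h, cmp_eq_lt_iff _ _ |>.2 ((hs p hp q hq).1 h)]
    · have h2 : p.2 = q.2 := by
        apply le_antisymm
        · exact not_lt.1 fun h' => (((hs q hq p hp).2 h').ne h.symm)
        · exact not_lt.1 fun h' => (((hs p hp q hq).2 h').ne h)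
      rw [h, h2, cmp_self_eq_eq, cmp_self_eq_eq]
    · rw [cmp_eq_gt_iff _ _ |>.2 h, cmp_eq_gt_iff _ _ |>.2 ((hs q hq p hp).1 h)]
  -- Back-and-forth started at `g`: an ideal of finite partial isomorphisms that contains `g` and
  -- meets every "defined at a point" set glues to an automorphism.
  let g : Order.PartialIso ℚ ℚ := ⟨s, hcmp⟩
  let C : ℚ ⊕ ℚ → Order.Cofinal (Order.PartialIso ℚ ℚ) := fun p =>
    Sum.recOn p (Order.PartialIso.definedAtLeft ℚ) (Order.PartialIso.definedAtRight ℚ)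
  let I := Order.idealOfCofinals g C
  let F a := Order.PartialIso.funOfIdeal a I (Order.cofinal_meets_idealOfCofinals g C (Sum.inl a))
  let G b := Order.PartialIso.invOfIdeal b I (Order.cofinal_meets_idealOfCofinals g C (Sum.inr b))
  refine ⟨OrderIso.ofCmpEqCmp (fun a => (F a).val) (fun b => (G b).val) ?_, ?_⟩
  · intro a b
    rcases (F a).prop with ⟨f, hf, ha⟩
    rcases (G b).prop with ⟨f', hf', hb⟩
    rcases I.directed _ hf _ hf' with ⟨m, _, fm, f'm⟩
    exact m.prop (a, _) (fm ha) (_, b) (f'm hb)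
  · intro p hp
    change (F p.1).val = p.2
    rcases (F p.1).prop with ⟨f, hf, ha⟩
    -- A common extension of `g` and of the approximation defined at `p.1` forces both values at
    -- `p.1` to agree.
    rcases I.directed _ hf _ (Order.mem_idealOfCofinals g C) with ⟨m, _, fm, f'm⟩
    have h := m.prop (p.1, _) (fm ha) p (f'm hp)
    rw [cmp_self_eq_eq] at h
    exact (cmp_eq_eq_iff _ _).1 h.symm

/-- A finite subset of a linear order maps strictly monotonically into any infinite linear order. -/
theorem exists_strictMonoOn_finset {D E : Type*} [LinearOrder D] [LinearOrder E] [Infinite E]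
    (V : Finset D) : ∃ f : D → E, StrictMonoOn f V := by
  classical
  obtain ⟨t, ht⟩ := Infinite.exists_subset_card_eq E V.card
  obtain ⟨e₀⟩ : Nonempty E := inferInstance
  refine ⟨fun x => if h : x ∈ V then
    t.orderEmbOfFin ht ((V.orderIsoOfFin rfl).symm ⟨x, h⟩) else e₀, ?_⟩
  intro x hx y hy hxy
  rw [Finset.mem_coe] at hx hy
  simpa [hx, hy] using hxy

/-! ### Raw configurations and raw steps -/

/-- Configurations without position, with numbers for types, letters and states, and a list of
threads: (type, letter, datum, threads). -/
abbrev RawConf (D : Type*) := ℕ × ℕ × D × List (ℕ × D)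

/-- The code of the instruction of state `q`. -/
def ARACode.instr (c : ARACode) (q : ℕ) : ℕ × ℕ × ℕ := c.2.2.2.getD q (0, 0, 0)

/-- Validity of the data test with code `x`. -/
def RawTest {D : Type*} [LinearOrder D] (x : ℕ) (d v : D) : Prop :=
  x = 0 ∧ d < v ∨ x = 1 ∧ v < d ∨ x = 2 ∧ d = v ∨ x = 3 ∧ d ≠ v

instance {D : Type*} [LinearOrder D] (x : ℕ) (d v : D) : Decidable (RawTest x d v) := by
  unfold RawTest; infer_instance

/-- The possible lists of new threads produced when a thread with register value `v` executes the
instruction with code `i`. Here `e` is the guessed datum and `E` the list of other threads. -/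
def spawn {D : Type*} [LinearOrder D] (c : ARACode) (α a : ℕ) (d v e : D) (E : List (ℕ × D))
    (i : ℕ × ℕ × ℕ) : List (List (ℕ × D)) :=
  if i.1 = 0 ∧ i.2.1 = a ∨ i.1 = 1 ∧ i.2.1 ≠ a ∨ i.1 = 2 ∧ i.2.1 = α ∨
      i.1 = 4 ∧ RawTest i.2.1 d v then [[]]
  else if i.1 = 3 then [[(i.2.1, d)]]
  else if i.1 = 5 then [[(i.2.1, v), (i.2.2, v)]]
  else if i.1 = 6 then [[(i.2.1, v)], [(i.2.2, v)]]
  else if i.1 = 8 then [[(i.2.1, e)]]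
  else if i.1 = 9 ∧ ∀ p ∈ E, (c.instr p.1).1 = 9 ∨ (c.instr p.1).1 = 7 then
    [(E.filter fun p => p.1 = i.2.1).map fun p => (i.2.2, p.2)]
  else []

/-- The threads other than `p`. -/
def others {D : Type*} [DecidableEq D] (T : List (ℕ × D)) (p : ℕ × D) : List (ℕ × D) :=
  T.filter (· ≠ p)

/-- The threads after a moving step. -/
def advance {D : Type*} (c : ARACode) (T : List (ℕ × D)) : List (ℕ × D) :=
  T.map fun p => ((c.instr p.1).2.1, p.2)

/-- The step relation on raw configurations; the executed thread is always removed. -/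
inductive RStep {D : Type*} [LinearOrder D] (c : ARACode) : RawConf D → RawConf D → Prop
  | eps {α a d T p N} (e : D) (hp : p ∈ T)
      (hN : N ∈ spawn c α a d p.2 e (others T p) (c.instr p.1)) :
      RStep c (α, a, d, T) (α, a, d, N ++ others T p)
  | move {a d T α' a'} (d' : D) (hT : ∀ p ∈ T, (c.instr p.1).1 = 7) (hα : α' < 2) (ha : a' < c.1) :
      RStep c (0, a, d, T) (α', a', d', advance c T)

/-- Initial raw configurations. -/
def rawInit {D : Type*} (c : ARACode) (α a : ℕ) (d : D) : RawConf D := (α, a, d, [(c.2.2.1, d)])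

/-- Existence of an accepting raw run. -/
def RawNonempty (c : ARACode) (D : Type*) [LinearOrder D] : Prop :=
  ∃ α < 2, ∃ a < c.1, ∃ d : D, ∃ K, Relation.ReflTransGen (RStep c) (rawInit c α a d) K ∧
    K.2.2.2 = []

/-! ### Invariance under monotone renaming of data -/

/-- Renaming of the data values. -/
def RawConf.map {D E : Type*} (f : D → E) (K : RawConf D) : RawConf E :=
  (K.1, K.2.1, f K.2.2.1, K.2.2.2.map (Prod.map id f))

theorem RawConf.map_map {D E F : Type*} (f : D → E) (g : E → F) (K : RawConf D) :
    (K.map f).map g = K.map (g ∘ f) := by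
  simp [RawConf.map]

theorem RawConf.map_congr {D E : Type*} {f g : D → E} {K : RawConf D} (hd : f K.2.2.1 = g K.2.2.1)
    (hT : ∀ p ∈ K.2.2.2, f p.2 = g p.2) : K.map f = K.map g := by
  simp only [RawConf.map, hd, Prod.mk.injEq, true_and, List.map_inj_left]
  intro p hp
  simp [Prod.map, hT p hp]

theorem RawConf.map_id {D : Type*} (K : RawConf D) : K.map id = K := by
  simp [RawConf.map]

theorem rawTest_map {D E : Type*} [LinearOrder D] [LinearOrder E] {f : D → E} {V : Set D}
    (hf : StrictMonoOn f V) {d v : D} (hd : d ∈ V) (hv : v ∈ V) (x : ℕ) :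
    RawTest x (f d) (f v) ↔ RawTest x d v := by
  simp only [RawTest, hf.lt_iff_lt hd hv, hf.lt_iff_lt hv hd, ne_eq, hf.injOn.eq_iff hd hv]

/-- The only comparison of data is the test between `d` and `v`; the guess `e` and the data in `L`
are merely copied, so `f` need not be monotone on them. -/
theorem spawn_map {D E : Type*} [LinearOrder D] [LinearOrder E] {f : D → E} {V : Set D}
    (hf : StrictMonoOn f V) {d v : D} (hd : d ∈ V) (hv : v ∈ V) (c : ARACode) (α a : ℕ) (e : D)
    (L : List (ℕ × D)) (i : ℕ × ℕ × ℕ) :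
    spawn c α a (f d) (f v) (f e) (L.map (Prod.map id f)) i =
      (spawn c α a d v e L i).map (List.map (Prod.map id f)) := by
  unfold spawn
  simp only [rawTest_map hf hd hv, List.forall_mem_map, Prod.map_fst, id]
  split_ifs <;> simp_all [List.filter_map, Function.comp_def]

theorem others_map {D E : Type*} [LinearOrder D] [LinearOrder E] {f : D → E} {V : Set D}
    (hf : StrictMonoOn f V) {T : List (ℕ × D)} (hT : ∀ p ∈ T, p.2 ∈ V) {p : ℕ × D}
    (hp : p.2 ∈ V) :
    others (T.map (Prod.map id f)) (Prod.map id f p) = (others T p).map (Prod.map id f) := by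
  unfold others
  rw [List.filter_map]
  congr 1
  apply List.filter_congr
  intro q hq
  simp [Prod.ext_iff, hf.injOn.eq_iff (hT q hq) hp]

theorem advance_map {D E : Type*} (f : D → E) (c : ARACode) (T : List (ℕ × D)) :
    advance c (T.map (Prod.map id f)) = (advance c T).map (Prod.map id f) := by
  simp [advance]

/-- Monotonicity is needed only on the data that the step compares. Keeping this set finite matters
because `D` need not embed into `E`. -/
theorem RStep.map_of_strictMonoOn {D E : Type*} [LinearOrder D] [LinearOrder E] {c : ARACode}
    {K K' : RawConf D} (h : RStep c K K') :
    ∃ V : Finset D, ∀ f : D → E, StrictMonoOn f V → RStep c (K.map f) (K'.map f) := by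
  classical
  cases h with
  | @eps α a d T p N e hp hN =>
    refine ⟨insert d (T.map Prod.snd).toFinset, fun f hf => ?_⟩
    have hT : ∀ q ∈ T, q.2 ∈ ((insert d (T.map Prod.snd).toFinset : Finset D) : Set D) := by
      intro q hq
      rw [Finset.mem_coe, Finset.mem_insert, List.mem_toFinset]
      exact Or.inr (List.mem_map_of_mem hq)
    have hd : d ∈ ((insert d (T.map Prod.snd).toFinset : Finset D) : Set D) := by simp
    have h := RStep.eps (c := c) (α := α) (a := a) (d := f d) (T := T.map (Prod.map id f))
      (p := Prod.map id f p) (N := N.map (Prod.map id f)) (f e) (List.mem_map_of_mem hp) (by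
        rw [others_map hf hT (hT p hp)]
        have := spawn_map hf hd (hT p hp) c α a e (others T p) (c.instr p.1)
        simp only [Prod.map_fst, Prod.map_snd, id]
        rw [this]
        exact List.mem_map_of_mem hN)
    rw [others_map hf hT (hT p hp), ← List.map_append] at h
    exact h
  | @move a d T α' a' d' hT hα ha =>
    refine ⟨∅, fun f _ => ?_⟩
    have h := RStep.move (c := c) (a := a) (d := f d) (T := T.map (Prod.map id f)) (f d')
      (List.forall_mem_map.2 hT) hα ha
    rw [advance_map] at h
    exact h

theorem RStep.map {D E : Type*} [LinearOrder D] [LinearOrder E] {c : ARACode} {K K' : RawConf D}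
    (h : RStep c K K') {f : D → E} (hf : StrictMono f) : RStep c (K.map f) (K'.map f) :=
  let ⟨_, hV⟩ := h.map_of_strictMonoOn (E := E)
  hV f (hf.strictMonoOn _)

theorem exists_map_reflTransGen {D E : Type*} [LinearOrder D] [LinearOrder E] {c : ARACode}
    {K K' : RawConf D} (h : Relation.ReflTransGen (RStep c) K K') :
    ∃ V : Finset D, ∀ f : D → E, StrictMonoOn f V →
      Relation.ReflTransGen (RStep c) (K.map f) (K'.map f) := by
  classical
  induction h with
  | refl => exact ⟨∅, fun _ _ => .refl⟩
  | tail _ h ih =>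
    obtain ⟨V, hV⟩ := ih
    obtain ⟨W, hW⟩ := h.map_of_strictMonoOn (E := E)
    refine ⟨V ∪ W, fun f hf => (hV f (hf.mono ?_)).tail (hW f (hf.mono ?_))⟩ <;> simp

/-- The data domain does not matter for the existence of accepting raw runs. -/
theorem RawNonempty.transfer {D : Type*} [LinearOrder D] {c : ARACode} (h : RawNonempty c D)
    (E : Type*) [LinearOrder E] [Infinite E] : RawNonempty c E := by
  obtain ⟨α, hα, a, ha, d, K, hK, hT⟩ := h
  obtain ⟨V, hV⟩ := exists_map_reflTransGen (E := E) hK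
  obtain ⟨f, hf⟩ := exists_strictMonoOn_finset (E := E) V
  refine ⟨α, hα, a, ha, f d, K.map f, ?_, by simp [RawConf.map, hT]⟩
  simpa [RawConf.map, rawInit] using hV f hf

/-! ### Removing threads -/

/-- `K` has the type, letter and datum of `K'`, and its threads are threads of `K'`. -/
def RawSub {D : Type*} (K K' : RawConf D) : Prop :=
  K.1 = K'.1 ∧ K.2.1 = K'.2.1 ∧ K.2.2.1 = K'.2.2.1 ∧ K.2.2.2 ⊆ K'.2.2.2

theorem RawSub.trans {D : Type*} {K₁ K₂ K₃ : RawConf D} (h : RawSub K₁ K₂) (h' : RawSub K₂ K₃) :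
    RawSub K₁ K₃ :=
  ⟨h.1.trans h'.1, h.2.1.trans h'.2.1, h.2.2.1.trans h'.2.2.1, fun _ hp => h'.2.2.2 (h.2.2.2 hp)⟩

theorem RawSub.map {D E : Type*} {K K' : RawConf D} (h : RawSub K K') (f : D → E) :
    RawSub (K.map f) (K'.map f) := by
  obtain ⟨h₁, h₂, h₃, h₄⟩ := h
  exact ⟨h₁, h₂, congrArg f h₃, List.map_subset _ h₄⟩

/-- Only `spread` inspects the other threads. Its side condition survives the removal of threads,
and its output shrinks with them. -/
theorem exists_spawn_subset {D : Type*} [LinearOrder D] {c : ARACode} {α a : ℕ} {d v e : D}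
    {L L' : List (ℕ × D)} (hL : L ⊆ L') {i : ℕ × ℕ × ℕ} {N' : List (ℕ × D)}
    (hN : N' ∈ spawn c α a d v e L' i) : ∃ N ∈ spawn c α a d v e L i, N ⊆ N' := by
  unfold spawn at hN ⊢
  by_cases h9 : i.1 = 9
  · simp only [h9, OfNat.ofNat_ne_zero, false_and, OfNat.ofNat_ne_one, Nat.reduceEqDiff, or_self,
      if_false, true_and] at hN ⊢
    split_ifs at hN with h
    · rw [if_pos fun p hp => h p (hL hp)]
      refine ⟨_, List.mem_singleton_self _, ?_⟩
      rw [List.mem_singleton.1 hN]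
      exact List.map_subset _ (List.filter_subset _ hL)
    · simp at hN
  · simp only [h9, false_and, if_false] at hN ⊢
    exact ⟨N', hN, List.Subset.refl _⟩

theorem others_subset {D : Type*} [DecidableEq D] {T T' : List (ℕ × D)} (h : T ⊆ T') (p : ℕ × D) :
    others T p ⊆ others T' p := List.filter_subset _ h

/-- The raw steps are compatible with removing threads. -/
theorem RawSub.step {D : Type*} [LinearOrder D] {c : ARACode} {K K' K₁' : RawConf D}
    (h : RawSub K K') (hs : RStep c K' K₁') : RawSub K K₁' ∨ ∃ K₁, RStep c K K₁ ∧ RawSub K₁ K₁' := by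
  obtain ⟨α, a, d, T⟩ := K
  obtain ⟨h₁, h₂, h₃, h₄⟩ := h
  cases hs with
  | @eps α a d T' p N e hp hN =>
    dsimp only at h₁ h₂ h₃ h₄
    subst h₁ h₂ h₃
    -- If `K` has the executed thread, it imitates the step. Otherwise all its threads survive among
    -- the others, and it waits.
    by_cases hpT : p ∈ T
    · obtain ⟨N₁, hN₁, hsub⟩ := exists_spawn_subset (others_subset h₄ p) hN
      refine Or.inr ⟨_, .eps e hpT hN₁, rfl, rfl, rfl, ?_⟩
      exact List.append_subset.2 ⟨fun _ hx => List.mem_append_left _ (hsub hx),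
        fun _ hx => List.mem_append_right _ (others_subset h₄ p hx)⟩
    · refine Or.inl ⟨rfl, rfl, rfl, fun x hx => List.mem_append_right _ ?_⟩
      refine List.mem_filter.2 ⟨h₄ hx, ?_⟩
      simpa using fun hxp : x = p => hpT (hxp ▸ hx)
  | @move a d T' α' a' d' hT hα ha =>
    dsimp only at h₁ h₂ h₃ h₄
    subst h₁ h₂ h₃
    exact Or.inr ⟨_, .move d' (fun p hp => hT p (h₄ hp)) hα ha, rfl, rfl, rfl,
      List.map_subset _ h₄⟩

/-! ### Automaton runs versus raw runs -/

section Link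

/-- A thread with the state as a number. -/
def rawThread {m : ℕ} {D : Type*} (t : Fin m × D) : ℕ × D := (t.1, t.2)

theorem rawThread_injective {m : ℕ} {D : Type*} :
    Function.Injective (rawThread : Fin m × D → ℕ × D) := by
  rintro ⟨q, d⟩ ⟨q', d'⟩ h
  simpa [rawThread, Fin.ext_iff] using h

variable {n m : ℕ} {D : Type*} [LinearOrder D] (𝒜 : ARA (Fin n) (Fin m))

theorem ARA.code_instr (q : Fin m) : 𝒜.code.instr q = (𝒜.δ q).code := by
  simp [ARA.code, ARACode.instr, List.getD]

/-- The raw configuration of a configuration. -/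
noncomputable def Config.toRaw (C : Config (Fin n) (Fin m) D) : RawConf D :=
  (C.type.code, C.label.1, C.label.2, C.threads.toList.map rawThread)

/-- The executed thread may also belong to `Δ` and so survive in the automaton, while a raw step
always deletes it. The raw result is therefore only a part of `C'`. -/
theorem rawSub_toRaw_of_eps {C C' : Config (Fin n) (Fin m) D} {q : Fin m} {v e : D}
    {Δ : Finset (Fin m × D)} (hty : C'.type = C.type) (hla : C'.label = C.label)
    (hC : C.threads = insert (q, v) Δ) (hC' : Δ ⊆ C'.threads)
    (hN : ∀ E : List (ℕ × D), (∀ p ∈ E, ∃ t ∈ Δ, rawThread t = p) → ∃ N ∈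
      spawn 𝒜.code C.type.code C.label.1 C.label.2 v e E (𝒜.δ q).code,
      ∀ p ∈ N, ∃ t ∈ C'.threads, rawThread t = p) :
    ∃ K, RStep 𝒜.code C.toRaw K ∧ RawSub K C'.toRaw := by
  have hE : ∀ p ∈ others C.toRaw.2.2.2 (rawThread (q, v)), ∃ t ∈ Δ, rawThread t = p := by
    intro p hp
    simp only [others, Config.toRaw, List.mem_filter, List.mem_map, Finset.mem_toList, hC,
      decide_eq_true_eq, Finset.mem_insert] at hp
    obtain ⟨⟨t, rfl | ht, rfl⟩, hne⟩ := hp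
    · exact absurd rfl hne
    · exact ⟨t, ht, rfl⟩
  obtain ⟨N, hN, hsub⟩ := hN _ hE
  have hp : rawThread (q, v) ∈ C.toRaw.2.2.2 := by
    simp only [Config.toRaw, List.mem_map, Finset.mem_toList, hC]
    exact ⟨_, Finset.mem_insert_self _ _, rfl⟩
  have hstep := RStep.eps (c := 𝒜.code) (α := C.type.code) (a := C.label.1) (d := C.label.2) e hp
    (N := N) (by
      have : 𝒜.code.instr (rawThread (q, v)).1 = (𝒜.δ q).code := 𝒜.code_instr q
      rw [this]
      exact hN)
  refine ⟨_, hstep, by simp [Config.toRaw, hty], by simp [Config.toRaw, hla],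
    by simp [Config.toRaw, hla], ?_⟩
  intro p hp
  simp only [Config.toRaw, List.mem_map, Finset.mem_toList]
  rcases List.mem_append.1 hp with hp | hp
  · exact hsub p hp
  · obtain ⟨t, ht, rfl⟩ := hE p hp
    exact ⟨t, hC' ht, rfl⟩

theorem rawSub_toRaw_of_step {C C' : Config (Fin n) (Fin m) D} (h : 𝒜.Step C C') :
    ∃ K, RStep 𝒜.code C.toRaw K ∧ RawSub K C'.toRaw := by
  rcases h with h | h
  · obtain @⟨i, γ, Δ, α', γ', Δ', hΔ, hΔ'⟩ := h
    refine ⟨_, .move γ'.2 (α' := α'.code) (a' := γ'.1) ?_ ?_ γ'.1.isLt, rfl, rfl, rfl, ?_⟩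
    · intro p hp
      simp only [List.mem_map, Finset.mem_toList] at hp
      obtain ⟨t, ht, rfl⟩ := hp
      obtain ⟨q', hq'⟩ := hΔ t ht
      have : 𝒜.code.instr (rawThread t).1 = (𝒜.δ t.1).code := 𝒜.code_instr t.1
      rw [this, hq']
      rfl
    · cases α' <;> decide
    · intro p hp
      simp only [advance, List.map_map, List.mem_map, Finset.mem_toList] at hp
      obtain ⟨t, ht, rfl⟩ := hp
      obtain ⟨q', hq'⟩ := hΔ t ht
      have : 𝒜.code.instr (rawThread t).1 = (𝒜.δ t.1).code := 𝒜.code_instr t.1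
      simp only [Config.toRaw, List.mem_map, Finset.mem_toList, Function.comp, this, hq']
      exact ⟨(q', t.2), (hΔ' _ _).2 ⟨t.1, ht, hq'⟩, rfl⟩
  · cases h with
    | @orLeft i α a d q d' Δ q₁ q₂ h =>
      refine rawSub_toRaw_of_eps 𝒜 (e := d) rfl rfl rfl (Finset.subset_insert _ _) ?_
      intro E hE
      refine ⟨[(q₁, d')], by simp [h, Instr.code, spawn], ?_⟩
      simp [rawThread]
    | @orRight i α a d q d' Δ q₁ q₂ h =>
      refine rawSub_toRaw_of_eps 𝒜 (e := d) rfl rfl rfl (Finset.subset_insert _ _) ?_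
      intro E hE
      refine ⟨[(q₂, d')], by simp [h, Instr.code, spawn], ?_⟩
      simp [rawThread]
    | @and i α a d q d' Δ q₁ q₂ h =>
      refine rawSub_toRaw_of_eps 𝒜 (e := d) rfl rfl rfl ?_ ?_
      · exact (Finset.subset_insert _ _).trans (Finset.subset_insert _ _)
      intro E hE
      refine ⟨[(q₁, d'), (q₂, d')], by simp [h, Instr.code, spawn], ?_⟩
      simp [rawThread]
    | @store i α a d q d' Δ q' h =>
      refine rawSub_toRaw_of_eps 𝒜 (e := d) rfl rfl rfl (Finset.subset_insert _ _) ?_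
      intro E hE
      refine ⟨[(q', d)], by simp [h, Instr.code, spawn], ?_⟩
      simp [rawThread]
    | @test i α a d q d' Δ t h ht =>
      refine rawSub_toRaw_of_eps 𝒜 (e := d) rfl rfl rfl (Finset.Subset.refl _) ?_
      intro E hE
      refine ⟨[], ?_, by simp⟩
      cases t <;> simp_all [Instr.code, spawn, RawTest, DataTest.code, DataTest.Holds]
    | @isType i α a d q d' Δ h =>
      refine rawSub_toRaw_of_eps 𝒜 (e := d) rfl rfl rfl (Finset.Subset.refl _) ?_
      intro E hE
      exact ⟨[], by simp [h, Instr.code, spawn], by simp⟩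
    | @letter i α a d q d' Δ h =>
      refine rawSub_toRaw_of_eps 𝒜 (e := d) rfl rfl rfl (Finset.Subset.refl _) ?_
      intro E hE
      exact ⟨[], by simp [h, Instr.code, spawn], by simp⟩
    | @notLetter i α a d q d' Δ b h hb =>
      refine rawSub_toRaw_of_eps 𝒜 (e := d) rfl rfl rfl (Finset.Subset.refl _) ?_
      intro E hE
      exact ⟨[], by simp [h, Instr.code, spawn, Fin.val_inj, hb], by simp⟩
    | @guess i α a d q d' Δ q' h e =>
      refine rawSub_toRaw_of_eps 𝒜 (e := e) rfl rfl rfl (Finset.subset_insert _ _) ?_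
      intro E hE
      refine ⟨[(q', e)], by simp [h, Instr.code, spawn], ?_⟩
      simp [rawThread]
    | @spread i α a d q d' Δ q₂ q₁ h hΔ =>
      refine rawSub_toRaw_of_eps 𝒜 (e := d) rfl rfl rfl Finset.subset_union_right ?_
      intro E hE
      refine ⟨(E.filter fun p => p.1 = (q₂ : ℕ)).map fun p => (↑q₁, p.2), ?_, ?_⟩
      · have : ∀ p ∈ E, (𝒜.code.instr p.1).1 = 9 ∨ (𝒜.code.instr p.1).1 = 7 := by
          intro p hp
          obtain ⟨t, ht, rfl⟩ := hE p hp
          have : 𝒜.code.instr (rawThread t).1 = (𝒜.δ t.1).code := 𝒜.code_instr t.1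
          rw [this]
          rcases hΔ t ht with ⟨_, _, h⟩ | ⟨_, h⟩ <;> simp [h, Instr.code]
        simp only [h, Instr.code, spawn]
        simpa using fun q v => this (q, v)
      · intro p hp
        simp only [List.mem_map, List.mem_filter, decide_eq_true_eq] at hp
        obtain ⟨p, ⟨hp, hp1⟩, rfl⟩ := hp
        obtain ⟨t, ht, rfl⟩ := hE p hp
        refine ⟨(q₁, t.2), ?_, rfl⟩
        simp only [Finset.mem_union, Finset.mem_image, Finset.mem_filter]
        exact Or.inl ⟨t, ⟨ht, Fin.ext hp1⟩, rfl⟩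

/-- The losses of threads accumulate harmlessly, because `RawSub.step` lets the smaller raw
configuration follow or wait. -/
theorem exists_raw_run {C C' : Config (Fin n) (Fin m) D} (h : ReflTransGen 𝒜.Step C C') :
    ∃ K, ReflTransGen (RStep 𝒜.code) C.toRaw K ∧ RawSub K C'.toRaw := by
  induction h with
  | refl => exact ⟨_, .refl, rfl, rfl, rfl, List.Subset.refl _⟩
  | @tail C₁ C₂ _ h ih =>
    obtain ⟨K, hK, hsub⟩ := ih
    obtain ⟨K₁, h₁, hsub₁⟩ := rawSub_toRaw_of_step 𝒜 h
    rcases hsub.step h₁ with h | ⟨K₂, h₂, hsub₂⟩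
    · exact ⟨K, hK, h.trans hsub₁⟩
    · exact ⟨K₂, hK.tail h₂, hsub₂.trans hsub₁⟩

theorem rawNonempty_of_accepts {w : DataWord (Fin n) D} (h : 𝒜.Accepts w) :
    RawNonempty 𝒜.code D := by
  obtain ⟨r, hr, hlast⟩ := h
  have hchain : ReflTransGen 𝒜.Step (r.head hr.ne_nil) (r.getLast hr.ne_nil) := by
    obtain ⟨ne, hc, -⟩ := hr
    cases r with
    | nil => exact absurd rfl ne
    | cons a l => exact List.relationReflTransGen_of_exists_isChain_cons l hc rfl
  obtain ⟨K, hK, -, -, -, hT⟩ := exists_raw_run 𝒜 hchain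
  have hl := hr.label_eq _ (List.head_mem hr.ne_nil)
  refine ⟨(r.head hr.ne_nil).type.code, ?_, (r.head hr.ne_nil).label.1, (r.head hr.ne_nil).label.1.isLt,
    (r.head hr.ne_nil).label.2, K, ?_, ?_⟩
  · cases (r.head hr.ne_nil).type <;> decide
  · have : (w.1.head w.2).2 = (r.head hr.ne_nil).label.2 := by
      rw [hr.head_pos, ← List.head?_eq_getElem?, List.head?_eq_some_head w.2] at hl
      rw [Option.some.inj hl]
    have h0 : (r.head hr.ne_nil).toRaw = rawInit 𝒜.code (r.head hr.ne_nil).type.code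
        (r.head hr.ne_nil).label.1 (r.head hr.ne_nil).label.2 := by
      simp [Config.toRaw, hr.head_threads, rawInit, rawThread, ARA.code, this]
    rw [← h0]
    exact hK
  · have : (r.getLast hr.ne_nil).toRaw.2.2.2 = [] := by simp [Config.toRaw, hlast]
    rw [this] at hT
    exact List.subset_nil.1 hT

/-- The raw configuration `K` has exactly the data of `C`. -/
def Represents (K : RawConf D) (C : Config (Fin n) (Fin m) D) : Prop :=
  K.1 = C.type.code ∧ K.2.1 = C.label.1 ∧ K.2.2.1 = C.label.2 ∧
    ∀ p, p ∈ K.2.2.2 ↔ ∃ t ∈ C.threads, rawThread t = p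

/-- This direction is exact: the automaton may choose the decomposition in which the executed thread
is absent from `Δ`, and this is what a raw step does. -/
theorem exists_step_of_rStep {K K' : RawConf D} {C : Config (Fin n) (Fin m) D}
    (hK : Represents K C) (h : RStep 𝒜.code K K') : ∃ C', 𝒜.Step C C' ∧ Represents K' C' := by
  obtain ⟨i, type, ⟨a₀, d₀⟩, S⟩ := C
  cases h with
  | @eps α a d T p N e hp hN =>
    obtain ⟨h₁, h₂, h₃, hT⟩ := hK
    dsimp only at h₁ h₂ h₃ hT
    subst h₁ h₂ h₃
    obtain ⟨⟨q, v⟩, hqv, rfl⟩ := (hT p).1 hp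
    have hE : ∀ x, x ∈ others T (rawThread (q, v)) ↔
        ∃ t ∈ S.erase (q, v), rawThread t = x := by
      intro x
      simp only [others, List.mem_filter, hT, decide_eq_true_eq, Finset.mem_erase]
      constructor
      · rintro ⟨⟨t, ht, rfl⟩, hne⟩
        exact ⟨t, ⟨fun h => hne (by rw [h]), ht⟩, rfl⟩
      · rintro ⟨t, ⟨hne, ht⟩, rfl⟩
        exact ⟨⟨t, ht, rfl⟩, fun h => hne (rawThread_injective h)⟩
    obtain ⟨Δ, hΔ⟩ : ∃ Δ, Δ = S.erase (q, v) := ⟨_, rfl⟩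
    have hS : S = insert (q, v) Δ := by rw [hΔ, Finset.insert_erase hqv]
    rw [← hΔ] at hE
    have hin : 𝒜.code.instr (rawThread (q, v)).1 = (𝒜.δ q).code := 𝒜.code_instr q
    rw [hin] at hN
    generalize others T (rawThread (q, v)) = E at hE hN
    change N ∈ spawn 𝒜.code type.code a₀ d v e E _ at hN
    suffices ∃ Δ', 𝒜.StepEps ⟨i, type, (a₀, d), insert (q, v) Δ⟩ ⟨i, type, (a₀, d), Δ'⟩ ∧
        ∀ p, p ∈ N ++ E ↔ ∃ t ∈ Δ', rawThread t = p by
      obtain ⟨Δ', hs, hp⟩ := this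
      exact ⟨⟨i, type, (a₀, d), Δ'⟩, Or.inr (hS ▸ hs), rfl, rfl, rfl, hp⟩
    have hins : ∀ (q' : Fin m) (u : D) (M : List (ℕ × D)) (Δ' : Finset (Fin m × D)),
        (∀ p, p ∈ M ↔ ∃ t ∈ Δ', rawThread t = p) →
        ∀ p, p ∈ ((q' : ℕ), u) :: M ↔ ∃ t ∈ insert (q', u) Δ', rawThread t = p := by
      intro q' u M Δ' h p
      rw [List.mem_cons, h, Finset.exists_mem_insert, eq_comm]
      rfl
    cases hq : 𝒜.δ q with
    | letter b =>
      rw [hq] at hN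
      simp only [spawn, Instr.code] at hN
      simp [Fin.val_inj] at hN
      obtain ⟨rfl, rfl⟩ := hN
      exact ⟨Δ, .letter hq, hE⟩
    | notLetter b =>
      rw [hq] at hN
      simp only [spawn, Instr.code] at hN
      simp [Fin.val_inj] at hN
      obtain ⟨hb, rfl⟩ := hN
      exact ⟨Δ, .notLetter hq hb, hE⟩
    | isType t =>
      rw [hq] at hN
      have : t = type ∧ N = [] := by
        revert hN
        cases t <;> cases type <;> simp [spawn, Instr.code, PosType.code]
      obtain ⟨rfl, rfl⟩ := this
      exact ⟨Δ, .isType hq, hE⟩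
    | test t =>
      rw [hq] at hN
      have : t.Holds d v ∧ N = [] := by
        revert hN
        cases t <;> simp [spawn, Instr.code, DataTest.code, RawTest, DataTest.Holds]
      obtain ⟨ht, rfl⟩ := this
      exact ⟨Δ, .test hq ht, hE⟩
    | store q' =>
      rw [hq] at hN
      simp [spawn, Instr.code] at hN
      subst hN
      exact ⟨_, .store hq, hins _ _ _ _ hE⟩
    | and q₁ q₂ =>
      rw [hq] at hN
      simp [spawn, Instr.code] at hN
      subst hN
      exact ⟨_, .and hq, hins _ _ _ _ (hins _ _ _ _ hE)⟩
    | or q₁ q₂ =>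
      rw [hq] at hN
      simp [spawn, Instr.code] at hN
      rcases hN with rfl | rfl
      · exact ⟨_, .orLeft hq, hins _ _ _ _ hE⟩
      · exact ⟨_, .orRight hq, hins _ _ _ _ hE⟩
    | move q' =>
      rw [hq] at hN
      simp [spawn, Instr.code] at hN
    | guess q' =>
      rw [hq] at hN
      simp [spawn, Instr.code] at hN
      subst hN
      exact ⟨_, .guess hq e, hins _ _ _ _ hE⟩
    | spread q₂ q₁ =>
      rw [hq] at hN
      have hN' : (∀ p ∈ E, (𝒜.code.instr p.1).1 = 9 ∨ (𝒜.code.instr p.1).1 = 7) ∧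
          N = (E.filter fun p => p.1 = (q₂ : ℕ)).map fun p => ((q₁ : ℕ), p.2) := by
        simp only [spawn, Instr.code, OfNat.ofNat_ne_zero, false_and, OfNat.ofNat_ne_one,
          Nat.reduceEqDiff, or_self, if_false, true_and] at hN
        split_ifs at hN with h
        · exact ⟨h, List.mem_singleton.1 hN⟩
        · simp at hN
      obtain ⟨hE', rfl⟩ := hN'
      refine ⟨_, .spread hq ?_, ?_⟩
      · intro t ht
        have := hE' _ ((hE _).2 ⟨t, ht, rfl⟩)
        have hin : 𝒜.code.instr (rawThread t).1 = (𝒜.δ t.1).code := 𝒜.code_instr t.1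
        rw [hin] at this
        unfold ARA.Spreading ARA.Moving
        revert this
        cases 𝒜.δ t.1 <;> simp [Instr.code]
      · intro p
        simp only [List.mem_append, List.mem_map, List.mem_filter, decide_eq_true_eq, hE,
          Finset.mem_union, Finset.mem_image, Finset.mem_filter]
        constructor
        · rintro (⟨_, ⟨⟨t, ht, rfl⟩, h⟩, rfl⟩ | ⟨t, ht, rfl⟩)
          · exact ⟨(q₁, t.2), Or.inl ⟨t, ⟨ht, Fin.ext h⟩, rfl⟩, rfl⟩
          · exact ⟨t, Or.inr ht, rfl⟩
        · rintro ⟨_, ⟨t, ⟨ht, h⟩, rfl⟩ | ht, rfl⟩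
          · exact Or.inl ⟨_, ⟨⟨t, ht, rfl⟩, congrArg Fin.val h⟩, rfl⟩
          · exact Or.inr ⟨_, ht, rfl⟩
  | @move a d T α' a' d' hT' hα ha =>
    obtain ⟨h₁, h₂, h₃, hT⟩ := hK
    dsimp only at h₁ h₂ h₃ hT
    have htype : type = .hasNext := by
      revert h₁
      cases type <;> simp [PosType.code]
    subst htype
    obtain ⟨α'', rfl⟩ : ∃ t : PosType, t.code = α' := by
      interval_cases α'
      exacts [⟨.hasNext, rfl⟩, ⟨.isLast, rfl⟩]
    have hmov : ∀ t ∈ S, 𝒜.Moving t.1 := by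
      intro t ht
      have := hT' _ ((hT _).2 ⟨t, ht, rfl⟩)
      have hin : 𝒜.code.instr (rawThread t).1 = (𝒜.δ t.1).code := 𝒜.code_instr t.1
      rw [hin] at this
      unfold ARA.Moving
      revert this
      cases 𝒜.δ t.1 <;> simp [Instr.code]
    -- The fallback value is irrelevant, as every state occurring in `S` is moving.
    let nxt : Fin m → Fin m := fun q => match 𝒜.δ q with
      | .move q' => q'
      | _ => q
    refine ⟨⟨i + 1, α'', (⟨a', ha⟩, d'), S.image fun t => (nxt t.1, t.2)⟩,
      Or.inl (.move hmov ?_), rfl, rfl, rfl, ?_⟩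
    · intro q' v
      simp only [Finset.mem_image, Prod.mk.injEq]
      constructor
      · rintro ⟨t, ht, rfl, rfl⟩
        obtain ⟨q', hq'⟩ := hmov t ht
        exact ⟨t.1, ht, by simp only [nxt, hq']⟩
      · rintro ⟨q, hq, hq'⟩
        exact ⟨(q, v), hq, by simp only [nxt, hq'], rfl⟩
    · intro p
      simp only [advance, List.mem_map, hT, Finset.exists_mem_image]
      constructor
      · rintro ⟨_, ⟨t, ht, rfl⟩, rfl⟩
        obtain ⟨q', hq'⟩ := hmov t ht
        have hin : 𝒜.code.instr (rawThread t).1 = (𝒜.δ t.1).code := 𝒜.code_instr t.1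
        refine ⟨t, ht, ?_⟩
        rw [hin]
        simp [nxt, hq', Instr.code, rawThread]
      · rintro ⟨t, ht, rfl⟩
        obtain ⟨q', hq'⟩ := hmov t ht
        have hin : 𝒜.code.instr (rawThread t).1 = (𝒜.δ t.1).code := 𝒜.code_instr t.1
        refine ⟨_, ⟨t, ht, rfl⟩, ?_⟩
        rw [hin]
        simp [nxt, hq', Instr.code, rawThread]

/-- The word is read off from the end of the run: a moving step prepends the label of its source,
and other steps leave the word unchanged. Positions are taken relative to `C.pos`, so the induction
can start at any configuration. -/
theorem exists_run_of_reflTransGen {A Q : Type*} [DecidableEq Q] {ℬ : ARA A Q}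
    {C C' : Config A Q D} (h : ReflTransGen ℬ.Step C C') (hC' : C'.threads = ∅) :
    ∃ (u : DataWord A D) (r : List (Config A Q D)), (C :: r).IsChain ℬ.Step ∧
      ((C :: r).getLast (List.cons_ne_nil _ _)).threads = ∅ ∧
      ∀ ρ ∈ C :: r, C.pos ≤ ρ.pos ∧ u.1[ρ.pos - C.pos]? = some ρ.label ∧
        ρ.type = u.posType (ρ.pos - C.pos) := by
  induction h using ReflTransGen.head_induction_on with
  | refl =>
    cases hty : C'.type with
    | hasNext =>
      -- The type `hasNext` requires one more position, which the run never visits, so its label is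
      -- arbitrary.
      exact ⟨⟨[C'.label, C'.label], by simp⟩, [], by simp, hC', by simp [hty, DataWord.posType]⟩
    | isLast =>
      exact ⟨⟨[C'.label], by simp⟩, [], by simp, hC', by simp [hty, DataWord.posType]⟩
  | @head C C₁ h _ ih =>
    obtain ⟨u, r, hr, hlast, hu⟩ := ih
    have hchain : (C :: C₁ :: r).IsChain ℬ.Step := List.isChain_cons_cons.2 ⟨h, hr⟩
    have h₁ := hu C₁ List.mem_cons_self
    have heps : C.pos = C₁.pos → C.label = C₁.label → C.type = C₁.type → ∀ ρ ∈ C :: C₁ :: r,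
        C.pos ≤ ρ.pos ∧ u.1[ρ.pos - C.pos]? = some ρ.label ∧
          ρ.type = u.posType (ρ.pos - C.pos) := by
      intro hp hl ht ρ hρ
      rcases List.mem_cons.1 hρ with rfl | hρ
      · rw [hl, ht, hp]
        exact h₁
      · rw [hp]
        exact hu ρ hρ
    rcases h with h | h
    · obtain @⟨i, γ, Δ, α', γ', Δ', -, -⟩ := h
      refine ⟨⟨γ :: u.1, by simp⟩, _, hchain, by simpa using hlast, ?_⟩
      intro ρ hρ
      rcases List.mem_cons.1 hρ with rfl | hρ
      · have := List.length_pos_of_ne_nil u.2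
        simp [DataWord.posType, this]
      · obtain ⟨hle, hlab, hty⟩ := hu ρ hρ
        dsimp only at hle hlab hty ⊢
        obtain ⟨k, hk⟩ := Nat.exists_eq_add_of_le hle
        have e1 : ρ.pos - (i + 1) = k := by omega
        have e2 : ρ.pos - i = k + 1 := by omega
        rw [e1] at hlab hty
        rw [e2]
        refine ⟨by omega, by simpa using hlab, ?_⟩
        rw [hty]
        simp [DataWord.posType]
    · refine ⟨u, _, hchain, by simpa using hlast, ?_⟩
      cases h <;> exact heps rfl rfl rfl

theorem exists_represents_of_run {α a : ℕ} (hα : α < 2) (ha : a < n) {d : D} {K : RawConf D}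
    (hK : ReflTransGen (RStep 𝒜.code) (rawInit 𝒜.code α a d) K) :
    ∃ (t : PosType) (C' : Config (Fin n) (Fin m) D),
      ReflTransGen 𝒜.Step ⟨0, t, (⟨a, ha⟩, d), {(𝒜.init, d)}⟩ C' ∧ Represents K C' := by
  obtain ⟨t, rfl⟩ : ∃ t : PosType, t.code = α := by
    interval_cases α
    exacts [⟨.hasNext, rfl⟩, ⟨.isLast, rfl⟩]
  refine ⟨t, ?_⟩
  induction hK with
  | refl =>
    refine ⟨_, .refl, rfl, rfl, rfl, fun p => ?_⟩
    simp [rawInit, rawThread, ARA.code, eq_comm]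
  | tail _ h ih =>
    obtain ⟨C₁, h₁, hrep⟩ := ih
    obtain ⟨C₂, h₂, hrep₂⟩ := exists_step_of_rStep 𝒜 hrep h
    exact ⟨C₂, h₁.tail h₂, hrep₂⟩

theorem exists_accepts_of_rawNonempty (h : RawNonempty 𝒜.code D) :
    ∃ w : DataWord (Fin n) D, 𝒜.Accepts w := by
  obtain ⟨α, hα, a, ha, d, K, hK, hT⟩ := h
  obtain ⟨t, C', hC', hKC'⟩ := exists_represents_of_run 𝒜 hα ha hK
  have hempty : C'.threads = ∅ := by
    refine Finset.eq_empty_of_forall_notMem fun t ht => ?_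
    have := (hKC'.2.2.2 _).2 ⟨t, ht, rfl⟩
    simp [hT] at this
  obtain ⟨u, r, hr, hlast, hu⟩ := exists_run_of_reflTransGen hC' hempty
  have h₀ : (u.1.head u.2).2 = d := by
    have := (hu _ List.mem_cons_self).2.1
    rw [Nat.sub_self, ← List.head?_eq_getElem?, List.head?_eq_some_head u.2] at this
    rw [Option.some.inj this]
  refine ⟨u, _ :: r, ⟨List.cons_ne_nil _ _, hr, rfl, ?_, ?_, ?_⟩, hlast⟩
  · simp [h₀]
  · intro ρ hρ
    exact (hu ρ hρ).2.1
  · intro ρ hρ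
    exact (hu ρ hρ).2.2

theorem language_eq_empty_iff : 𝒜.language D = ∅ ↔ ¬ RawNonempty 𝒜.code D := by
  rw [Set.eq_empty_iff_forall_notMem]
  constructor
  · intro h h'
    obtain ⟨w, hw⟩ := exists_accepts_of_rawNonempty 𝒜 h'
    exact h w hw
  · intro h w hw
    exact h (rawNonempty_of_accepts 𝒜 hw)

end Link

/-! ### The well-quasi-order on configurations over `ℚ` -/

/-- The quasi-order on configurations over `ℚ`: a renaming of `K` by an order automorphism is a
part of `K'`. -/
def RawLE (K K' : RawConf ℚ) : Prop := ∃ π : ℚ ≃o ℚ, RawSub (K.map π) K'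

theorem RawLE.trans {K₁ K₂ K₃ : RawConf ℚ} (h : RawLE K₁ K₂) (h' : RawLE K₂ K₃) : RawLE K₁ K₃ := by
  obtain ⟨π, hπ⟩ := h
  obtain ⟨σ, hσ⟩ := h'
  refine ⟨π.trans σ, ?_⟩
  rw [OrderIso.coe_trans, ← RawConf.map_map]
  exact (hπ.map σ).trans hσ

/-- The quasi-order is a downward simulation. -/
theorem RawLE.step {c : ARACode} {K K' K₁' : RawConf ℚ} (h : RawLE K K') (hs : RStep c K' K₁') :
    RawLE K K₁' ∨ ∃ K₁, RStep c K K₁ ∧ RawLE K₁ K₁' := by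
  obtain ⟨π, hπ⟩ := h
  rcases hπ.step hs with h | ⟨K₂, h₂, hsub⟩
  · exact Or.inl ⟨π, h⟩
  · have h₃ := h₂.map π.symm.strictMono
    rw [RawConf.map_map] at h₃
    have : (π.symm : ℚ → ℚ) ∘ π = id := by ext; simp
    rw [this, RawConf.map_id] at h₃
    refine Or.inr ⟨_, h₃, π, ?_⟩
    have : (π : ℚ → ℚ) ∘ π.symm = id := by ext; simp
    rwa [RawConf.map_map, this, RawConf.map_id]

/-- What a configuration says about the data value `v`. -/
def RawConf.profile (K : RawConf ℚ) (v : ℚ) : ℕ × ℕ × Prop × Set ℕ :=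
  (K.1, K.2.1, v = K.2.2.1, {q | (q, v) ∈ K.2.2.2})

/-- The data values of a configuration. -/
def RawConf.values {D : Type*} [DecidableEq D] (K : RawConf D) : Finset D :=
  insert K.2.2.1 (K.2.2.2.map Prod.snd).toFinset

theorem RawConf.datum_mem_values {D : Type*} [DecidableEq D] (K : RawConf D) :
    K.2.2.1 ∈ K.values := Finset.mem_insert_self _ _

theorem RawConf.snd_mem_values {D : Type*} [DecidableEq D] {K : RawConf D} {p : ℕ × D}
    (hp : p ∈ K.2.2.2) : p.2 ∈ K.values :=
  Finset.mem_insert_of_mem (List.mem_toFinset.2 (List.mem_map_of_mem hp))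

/-- The sequence of profiles of the data values in increasing order. -/
def RawConf.word (K : RawConf ℚ) : List (ℕ × ℕ × Prop × Set ℕ) :=
  (K.values.sort (· ≤ ·)).map K.profile

/-- A subword embedding matches the values of `K` increasingly with values of `K'` of equal profile.
The matching extends to an automorphism, and equality of profiles transports the datum and the
threads. -/
theorem RawLE.of_word {K K' : RawConf ℚ} (h : List.SublistForall₂ Eq K.word K'.word) :
    RawLE K K' := by
  rw [RawConf.word, RawConf.word, List.sublistForall₂_map_left_iff,
    List.sublistForall₂_map_right_iff, List.sublistForall₂_iff] at h
  obtain ⟨l, hl, hsub⟩ := h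
  have hs : (K.values.sort (· ≤ ·)).Pairwise (· < ·) := (Finset.sortedLT_sort _).pairwise
  have hls : l.Pairwise (· < ·) := (Finset.sortedLT_sort _).pairwise.sublist hsub
  rw [List.forall₂_iff_zip] at hl
  obtain ⟨hlen, hl⟩ := hl
  have hmem : ∀ v ∈ K.values, ∃ v', (v, v') ∈ (K.values.sort (· ≤ ·)).zip l := by
    intro v hv
    obtain ⟨i, hi, rfl⟩ := List.mem_iff_getElem.1 ((Finset.mem_sort (· ≤ ·)).2 hv)
    exact ⟨l[i], List.mem_iff_getElem.2 ⟨i, by rwa [List.length_zip, ← hlen, min_self], by simp⟩⟩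
  have key : ∀ {l : List ℚ}, l.Pairwise (· < ·) → ∀ (i j : ℕ) (hi : i < l.length)
      (hj : j < l.length), l[i] < l[j] ↔ i < j := by
    intro l h i j hi hj
    rw [List.pairwise_iff_getElem] at h
    refine ⟨fun hlt => ?_, fun hij => h i j hi hj hij⟩
    by_contra hij
    rcases (not_lt.1 hij).eq_or_lt with rfl | hij
    · exact lt_irrefl _ hlt
    · exact lt_asymm hlt (h j i hj hi hij)
  obtain ⟨π, hπ⟩ := exists_orderIso_extending ((K.values.sort (· ≤ ·)).zip l).toFinset (by
    intro p hp q hq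
    rw [List.mem_toFinset] at hp hq
    obtain ⟨i, hi, rfl⟩ := List.mem_iff_getElem.1 hp
    obtain ⟨j, hj, rfl⟩ := List.mem_iff_getElem.1 hq
    simp only [List.length_zip, lt_min_iff] at hi hj
    simp only [List.getElem_zip]
    rw [key hs _ _ hi.1 hj.1, key hls _ _ hi.2 hj.2])
  obtain ⟨v', hv'⟩ := hmem _ K.datum_mem_values
  have hd := hl hv'
  simp only [RawConf.profile, Prod.mk.injEq, eq_iff_iff, true_iff] at hd
  refine ⟨π, hd.1, hd.2.1, ?_, ?_⟩
  · rw [← hd.2.2.1]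
    exact hπ _ (List.mem_toFinset.2 hv')
  · intro p hp
    obtain ⟨⟨q, v⟩, hqv, rfl⟩ := List.mem_map.1 hp
    obtain ⟨v', hv'⟩ := hmem v (RawConf.snd_mem_values hqv)
    have hv := hl hv'
    simp only [RawConf.profile, Prod.mk.injEq] at hv
    have hq : q ∈ {q | (q, v') ∈ K'.2.2.2} := hv.2.2.2 ▸ hqv
    have : π v = v' := hπ _ (List.mem_toFinset.2 hv')
    simpa [this] using hq

/-- The configurations with letters below `n` and states below `m`. -/
def RawConf.Bounded {D : Type*} (n m : ℕ) (K : RawConf D) : Prop :=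
  K.1 < 2 ∧ K.2.1 < n ∧ ∀ p ∈ K.2.2.2, p.1 < m

/-- Bounded configurations have only finitely many possible profiles, so Higman's lemma applies to
their words. -/
theorem partiallyWellOrderedOn_rawLE (n m : ℕ) :
    {K : RawConf ℚ | K.Bounded n m}.PartiallyWellOrderedOn RawLE := by
  have hfin : (Set.Iio 2 ×ˢ Set.Iio n ×ˢ (Set.univ : Set Prop) ×ˢ (Set.Iio m).powerset :
      Set (ℕ × ℕ × Prop × Set ℕ)).Finite :=
    (Set.finite_Iio 2).prod ((Set.finite_Iio n).prod
      (Set.finite_univ.prod (Set.finite_Iio m).powerset))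
  have hpwo := Set.PartiallyWellOrderedOn.partiallyWellOrderedOn_sublistForall₂ Eq
    (hfin.partiallyWellOrderedOn (r := Eq))
  rw [Set.partiallyWellOrderedOn_iff_exists_lt] at hpwo ⊢
  intro f hf
  obtain ⟨i, j, hij, h⟩ := hpwo (fun k => (f k).word) (by
    intro k x hx
    obtain ⟨v, -, rfl⟩ := List.mem_map.1 hx
    obtain ⟨h₁, h₂, h₃⟩ := hf k
    exact ⟨h₁, h₂, Set.mem_univ _, fun q hq => h₃ _ hq⟩)
  exact ⟨i, j, hij, RawLE.of_word h⟩

/-- Without a finite basis one could keep choosing elements above none of the earlier ones, which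
gives a bad sequence. -/
theorem exists_finset_basis {α : Type*} {r : α → α → Prop} {s : Set α}
    (hs : s.PartiallyWellOrderedOn r) : ∃ t : Finset α, ↑t ⊆ s ∧ ∀ x ∈ s, ∃ y ∈ t, r y x := by
  by_contra! h
  obtain ⟨f, hf, hr⟩ := exists_seq_of_forall_finset_exists (· ∈ s) (fun y x => ¬ r y x) h
  obtain ⟨i, j, hij, h⟩ := Set.partiallyWellOrderedOn_iff_exists_lt.1 hs f hf
  exact hr i j hij h

/-! ### Enumeration of runs over `ℕ` -/

/-- All types, letters and data below `b` for the next position. -/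
def labels (c : ARACode) (b : ℕ) : List (ℕ × ℕ × ℕ) :=
  (List.range 2).flatMap fun α => (List.range c.1).flatMap fun a =>
    (List.range b).map fun d => (α, a, d)

/-- The initial configurations with datum below `b`. -/
def inits (c : ARACode) (b : ℕ) : List (RawConf ℕ) :=
  (labels c b).map fun l => rawInit c l.1 l.2.1 l.2.2

/-- The successors by a non-moving step with guesses below `b`. -/
def epsSuccs (c : ARACode) (b : ℕ) (K : RawConf ℕ) : List (RawConf ℕ) :=
  K.2.2.2.flatMap fun p => (List.range b).flatMap fun e =>
    (spawn c K.1 K.2.1 K.2.2.1 p.2 e (others K.2.2.2 p) (c.instr p.1)).map fun N =>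
      (K.1, K.2.1, K.2.2.1, N ++ others K.2.2.2 p)

/-- The successors by a moving step with new datum below `b`. -/
def moveSuccs (c : ARACode) (b : ℕ) (K : RawConf ℕ) : List (RawConf ℕ) :=
  if K.1 = 0 ∧ ∀ p ∈ K.2.2.2, (c.instr p.1).1 = 7 then
    (labels c b).map fun l => (l.1, l.2.1, l.2.2, advance c K.2.2.2)
  else []

/-- The successors with new data below `b`. -/
def succs (c : ARACode) (b : ℕ) (K : RawConf ℕ) : List (RawConf ℕ) :=
  epsSuccs c b K ++ moveSuccs c b K

theorem mem_labels {c : ARACode} {b : ℕ} {l : ℕ × ℕ × ℕ} :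
    l ∈ labels c b ↔ l.1 < 2 ∧ l.2.1 < c.1 ∧ l.2.2 < b := by
  simp only [labels, List.mem_flatMap, List.mem_map, List.mem_range]
  constructor
  · rintro ⟨α, hα, a, ha, d, hd, rfl⟩
    exact ⟨hα, ha, hd⟩
  · rintro ⟨hα, ha, hd⟩
    exact ⟨_, hα, _, ha, _, hd, rfl⟩

theorem mem_epsSuccs {c : ARACode} {b : ℕ} {K K' : RawConf ℕ} : K' ∈ epsSuccs c b K ↔
    ∃ p ∈ K.2.2.2, ∃ e < b, ∃ N ∈ spawn c K.1 K.2.1 K.2.2.1 p.2 e (others K.2.2.2 p)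
      (c.instr p.1), K' = (K.1, K.2.1, K.2.2.1, N ++ others K.2.2.2 p) := by
  simp only [epsSuccs, List.mem_flatMap, List.mem_map, List.mem_range, eq_comm]

theorem mem_moveSuccs {c : ARACode} {b : ℕ} {K K' : RawConf ℕ} : K' ∈ moveSuccs c b K ↔
    (K.1 = 0 ∧ ∀ p ∈ K.2.2.2, (c.instr p.1).1 = 7) ∧ ∃ α' < 2, ∃ a' < c.1, ∃ d' < b,
      K' = (α', a', d', advance c K.2.2.2) := by
  unfold moveSuccs
  split_ifs with h
  · simp only [List.mem_map, mem_labels, h, true_and]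
    constructor
    · rintro ⟨l, ⟨hα, ha, hd⟩, rfl⟩
      exact ⟨h.2, _, hα, _, ha, _, hd, rfl⟩
    · rintro ⟨-, α', hα, a', ha, d', hd, rfl⟩
      exact ⟨(α', a', d'), ⟨hα, ha, hd⟩, rfl⟩
  · simp only [h, false_and, List.not_mem_nil]

theorem rStep_of_mem_succs {c : ARACode} {b : ℕ} {K K' : RawConf ℕ} (h : K' ∈ succs c b K) :
    RStep c K K' := by
  obtain ⟨α, a, d, T⟩ := K
  rcases List.mem_append.1 h with h | h
  · obtain ⟨p, hp, e, -, N, hN, rfl⟩ := mem_epsSuccs.1 h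
    exact .eps e hp hN
  · obtain ⟨⟨rfl, hT⟩, α', hα, a', ha, d', -, rfl⟩ := mem_moveSuccs.1 h
    exact .move d' hT hα ha

theorem RStep.exists_mem_succs {c : ARACode} {K K' : RawConf ℕ} (h : RStep c K K') :
    ∃ b₀, ∀ b ≥ b₀, K' ∈ succs c b K := by
  cases h with
  | eps e hp hN =>
    exact ⟨e + 1, fun b hb => List.mem_append_left _ (mem_epsSuccs.2 ⟨_, hp, e, hb, _, hN, rfl⟩)⟩
  | move d' hT hα ha =>
    exact ⟨d' + 1, fun b hb => List.mem_append_right _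
      (mem_moveSuccs.2 ⟨⟨rfl, hT⟩, _, hα, _, ha, d', hb, rfl⟩)⟩

/-- The configurations reachable in `k` steps with data below `b`. -/
def reach (c : ARACode) (b k : ℕ) : List (RawConf ℕ) :=
  (fun L : List (RawConf ℕ) => L.flatMap (succs c b))^[k] (inits c b)

theorem reach_succ (c : ARACode) (b k : ℕ) :
    reach c b (k + 1) = (reach c b k).flatMap (succs c b) :=
  Function.iterate_succ_apply' _ _ _

theorem exists_run_of_mem_reach {c : ARACode} {b k : ℕ} {K : RawConf ℕ} (h : K ∈ reach c b k) :
    ∃ α < 2, ∃ a < c.1, ∃ d : ℕ, ReflTransGen (RStep c) (rawInit c α a d) K := by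
  induction k generalizing K with
  | zero =>
    obtain ⟨l, hl, rfl⟩ := List.mem_map.1 h
    obtain ⟨hα, ha, -⟩ := mem_labels.1 hl
    exact ⟨_, hα, _, ha, _, .refl⟩
  | succ k ih =>
    rw [reach_succ] at h
    obtain ⟨K₀, h₀, h₁⟩ := List.mem_flatMap.1 h
    obtain ⟨α, hα, a, ha, d, hK⟩ := ih h₀
    exact ⟨α, hα, a, ha, d, hK.tail (rStep_of_mem_succs h₁)⟩

/-- Stating this for all large `b` lets the bounds of the successive steps be merged by a maximum.
-/
theorem exists_mem_reach {c : ARACode} {α a d : ℕ} (hα : α < 2) (ha : a < c.1) {K : RawConf ℕ}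
    (h : ReflTransGen (RStep c) (rawInit c α a d) K) : ∃ b₀ k, ∀ b ≥ b₀, K ∈ reach c b k := by
  induction h with
  | refl =>
    exact ⟨d + 1, 0, fun b hb => List.mem_map.2 ⟨(α, a, d), mem_labels.2 ⟨hα, ha, hb⟩, rfl⟩⟩
  | tail _ h ih =>
    obtain ⟨b₁, k, hk⟩ := ih
    obtain ⟨b₂, h₂⟩ := h.exists_mem_succs
    refine ⟨max b₁ b₂, k + 1, fun b hb => ?_⟩
    rw [reach_succ]
    exact List.mem_flatMap.2 ⟨_, hk b (le_of_max_le_left hb), h₂ b (le_of_max_le_right hb)⟩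

/-- Existence of accepting runs by means of the enumeration. -/
theorem rawNonempty_iff_exists_reach (c : ARACode) :
    RawNonempty c ℕ ↔ ∃ b k, ∃ K ∈ reach c b k, K.2.2.2 = [] := by
  constructor
  · rintro ⟨α, hα, a, ha, d, K, hK, hT⟩
    obtain ⟨b, k, h⟩ := exists_mem_reach hα ha hK
    exact ⟨b, k, K, h b le_rfl, hT⟩
  · rintro ⟨b, k, K, hK, hT⟩
    obtain ⟨α, hα, a, ha, d, h⟩ := exists_run_of_mem_reach hK
    exact ⟨α, hα, a, ha, d, K, h, hT⟩

/-! ### Certificates of emptiness -/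

/-- The data values are odd and below `b`. -/
def OddBelow (b : ℕ) (K : RawConf ℕ) : Prop :=
  (K.2.2.1 % 2 = 1 ∧ K.2.2.1 < b) ∧ ∀ p ∈ K.2.2.2, p.2 % 2 = 1 ∧ p.2 < b

/-- The relation `x` is a strictly monotone matching that embeds `K` into `K'`. -/
def Embeds (x : List (ℕ × ℕ)) (K K' : RawConf ℕ) : Prop :=
  K.1 = K'.1 ∧ K.2.1 = K'.2.1 ∧ (K.2.2.1, K'.2.2.1) ∈ x ∧
    (∀ p ∈ K.2.2.2, ∃ y ∈ x, y.1 = p.2 ∧ (p.1, y.2) ∈ K'.2.2.2) ∧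
    ∀ y ∈ x, ∀ z ∈ x, y.1 < z.1 ↔ y.2 < z.2

/-- `S` is a finite set of nonaccepting configurations such that the initial configurations and
the successors of members of `S` lie above members of `S`, as witnessed by `M`. -/
def EmptinessCert (c : ARACode) (b : ℕ) (S : List (RawConf ℕ)) (M : List (List (ℕ × ℕ))) : Prop :=
  (∀ K ∈ S, K.2.2.2 ≠ [] ∧ OddBelow b K) ∧
    ∀ K' ∈ inits c (b + 1) ++ S.flatMap (succs c (b + 1)), ∃ K ∈ S, ∃ x ∈ M, Embeds x K K'

theorem natCast_rat_strictMono : StrictMono (Nat.cast : ℕ → ℚ) := Nat.strictMono_cast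

theorem Embeds.rawLE {x : List (ℕ × ℕ)} {K K' : RawConf ℕ} (h : Embeds x K K') :
    RawLE (K.map (Nat.cast : ℕ → ℚ)) (K'.map (Nat.cast : ℕ → ℚ)) := by
  obtain ⟨h₁, h₂, h₃, h₄, h₅⟩ := h
  obtain ⟨π, hπ⟩ := exists_orderIso_extending
    (x.map fun y => ((y.1 : ℚ), (y.2 : ℚ))).toFinset (by
      intro p hp q hq
      rw [List.mem_toFinset] at hp hq
      obtain ⟨y, hy, rfl⟩ := List.mem_map.1 hp
      obtain ⟨z, hz, rfl⟩ := List.mem_map.1 hq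
      simpa using h₅ y hy z hz)
  have hπ' : ∀ y ∈ x, π (y.1 : ℚ) = y.2 := fun y hy =>
    hπ ((y.1 : ℚ), (y.2 : ℚ)) (List.mem_toFinset.2 (List.mem_map_of_mem hy))
  refine ⟨π, h₁, h₂, hπ' _ h₃, ?_⟩
  simp only [RawConf.map, List.map_map]
  intro p hp
  obtain ⟨q, hq, rfl⟩ := List.mem_map.1 hp
  obtain ⟨y, hy, hy₁, hy₂⟩ := h₄ q hq
  refine List.mem_map.2 ⟨_, hy₂, ?_⟩
  simp [Prod.map, ← hy₁, hπ' y hy]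

theorem exists_embeds {K K' : RawConf ℕ}
    (h : RawLE (K.map (Nat.cast : ℕ → ℚ)) (K'.map (Nat.cast : ℕ → ℚ))) :
    ∃ x, Embeds x K K' := by
  obtain ⟨π, h₁, h₂, h₃, h₄⟩ := h
  have h₃ : π K.2.2.1 = K'.2.2.1 := h₃
  have hT : ∀ p ∈ K.2.2.2, ∃ v : ℕ, π (p.2 : ℚ) = v ∧ (p.1, v) ∈ K'.2.2.2 := by
    intro p hp
    have := h₄ (List.mem_map_of_mem (List.mem_map_of_mem hp))
    obtain ⟨q, hq, heq⟩ := List.mem_map.1 this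
    obtain ⟨e₁, e₂⟩ := Prod.ext_iff.1 heq
    have e₁ : q.1 = p.1 := e₁
    exact ⟨q.2, e₂.symm, e₁ ▸ hq⟩
  -- On the data of `K` the automorphism takes values among the data of `K'`, which are naturals, so
  -- the floor only undoes the cast.
  let x : List (ℕ × ℕ) := (K.2.2.1, K'.2.2.1) :: K.2.2.2.map fun p => (p.2, ⌊π (p.2 : ℚ)⌋₊)
  have hx : ∀ y ∈ x, (y.2 : ℚ) = π y.1 := by
    intro y hy
    rcases List.mem_cons.1 hy with rfl | hy
    · exact h₃.symm
    · obtain ⟨p, hp, rfl⟩ := List.mem_map.1 hy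
      obtain ⟨v, hv, -⟩ := hT p hp
      simp only [hv, Nat.floor_natCast]
  refine ⟨x, h₁, h₂, List.mem_cons_self, ?_, ?_⟩
  · intro p hp
    obtain ⟨v, hv, hv'⟩ := hT p hp
    refine ⟨_, List.mem_cons_of_mem _ (List.mem_map_of_mem hp), rfl, ?_⟩
    simpa only [hv, Nat.floor_natCast] using hv'
  · intro y hy z hz
    rw [← Nat.cast_lt (α := ℚ) (m := y.2), hx y hy, hx z hz, π.lt_iff_lt, Nat.cast_lt]

/-- Up to automorphism, a rational number lies at a number up to `b` relative to a set of odd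
numbers below `b`. -/
theorem exists_nat_position {b : ℕ} {V : Finset ℕ} (hV : ∀ v ∈ V, v % 2 = 1 ∧ v < b) (e : ℚ) :
    ∃ e' ≤ b, ∃ π : ℚ ≃o ℚ, π (e' : ℕ) = e ∧ ∀ v ∈ V, π (v : ℕ) = v := by
  by_cases he : ∃ v ∈ V, (v : ℚ) = e
  · obtain ⟨v, hv, rfl⟩ := he
    exact ⟨v, (hV v hv).2.le, OrderIso.refl ℚ, rfl, fun _ _ => rfl⟩
  push Not at he
  -- The successor of the largest value below `e`, or `0` if there is none: an even number, hence
  -- strictly between the odd neighbours of `e`.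
  obtain ⟨e', he'⟩ : ∃ e', e' = (V.filter fun v : ℕ => (v : ℚ) < e).sup (· + 1) := ⟨_, rfl⟩
  have hlt : ∀ v ∈ V, (v : ℚ) < e → v < e' := by
    intro v hv hve
    rw [he']
    have hm : v ∈ V.filter fun v : ℕ => (v : ℚ) < e := Finset.mem_filter.2 ⟨hv, hve⟩
    exact Finset.le_sup (f := (· + 1)) hm
  have hgt : ∀ v ∈ V, e < (v : ℚ) → e' < v := by
    intro v hv hve
    have hodd := (hV v hv).1
    rw [he', Finset.sup_lt_iff (by change 0 < v; omega)]
    intro w hw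
    obtain ⟨hw, hwe⟩ := Finset.mem_filter.1 hw
    have hwodd := (hV w hw).1
    have : w < v := Nat.cast_lt.1 (hwe.trans hve)
    omega
  have hlt' : ∀ v ∈ V, (v : ℚ) < e ↔ v < e' := fun v hv =>
    ⟨hlt v hv, fun h => (he v hv).lt_or_gt.resolve_right fun h' => (hgt v hv h').asymm h⟩
  have hgt' : ∀ v ∈ V, e < (v : ℚ) ↔ e' < v := fun v hv =>
    ⟨hgt v hv, fun h => (he v hv).lt_or_gt.resolve_left fun h' => (hlt v hv h').asymm h⟩
  obtain ⟨π, hπ⟩ := exists_orderIso_extending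
    (insert ((e' : ℚ), e) (V.image fun v : ℕ => ((v : ℚ), (v : ℚ)))) (by
      intro p hp q hq
      rw [Finset.mem_insert, Finset.mem_image] at hp hq
      rcases hp with rfl | ⟨v, hv, rfl⟩ <;> rcases hq with rfl | ⟨w, hw, rfl⟩
      · simp
      · simp [hgt' w hw]
      · simp [hlt' v hv]
      · simp)
  refine ⟨e', ?_, π, hπ _ (Finset.mem_insert_self _ _), fun v hv =>
    hπ ((v : ℚ), (v : ℚ)) (Finset.mem_insert_of_mem (Finset.mem_image_of_mem _ hv))⟩
  rw [he']
  exact Finset.sup_le fun w hw => (hV w (Finset.mem_filter.1 hw).1).2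

theorem OddBelow.mem_values {b : ℕ} {K : RawConf ℕ} (h : OddBelow b K) :
    ∀ v ∈ K.values, v % 2 = 1 ∧ v < b := by
  intro v hv
  rcases Finset.mem_insert.1 hv with rfl | hv
  · exact h.1
  · obtain ⟨p, hp, rfl⟩ := List.mem_map.1 (List.mem_toFinset.1 hv)
    exact h.2 p hp

/-- The enumerated successors of `K` represent all successors of `K` over `ℚ`. -/
theorem exists_mem_succs_rawLE {c : ARACode} {b : ℕ} {K : RawConf ℕ} (hK : OddBelow b K)
    {K' : RawConf ℚ} (h : RStep c (K.map (Nat.cast : ℕ → ℚ)) K') :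
    ∃ K₁ ∈ succs c (b + 1) K, RawLE (K₁.map (Nat.cast : ℕ → ℚ)) K' := by
  have hmap : ∀ π : ℚ ≃o ℚ, (∀ v ∈ K.values, π (v : ℕ) = v) →
      K.map (Nat.cast : ℕ → ℚ) = K.map (π ∘ (Nat.cast : ℕ → ℚ)) := fun π hπ =>
    RawConf.map_congr (hπ _ K.datum_mem_values).symm
      fun p hp => (hπ _ (RawConf.snd_mem_values hp)).symm
  have hle : ∀ (π : ℚ ≃o ℚ) (K₁ : RawConf ℕ),
      RawLE (K₁.map (Nat.cast : ℕ → ℚ)) (K₁.map (π ∘ (Nat.cast : ℕ → ℚ))) := fun π K₁ =>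
    ⟨π, by rw [RawConf.map_map]; exact ⟨rfl, rfl, rfl, fun _ => id⟩⟩
  have hmono : ∀ π : ℚ ≃o ℚ, StrictMonoOn (π ∘ (Nat.cast : ℕ → ℚ)) Set.univ := fun π =>
    (π.strictMono.comp natCast_rat_strictMono).strictMonoOn _
  obtain ⟨α, a, d, T⟩ := K
  generalize hK₀ : RawConf.map (Nat.cast : ℕ → ℚ) (α, a, d, T) = K₀ at h
  cases h with
  | @eps α' a' d₀ T₀ p N e hp hN =>
    -- As `π` fixes the data of `K` and sends `e'` to `e`, the step over `ℚ` is the image under `π`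
    -- of a step over `ℕ` that guesses `e'`.
    obtain ⟨e', he', π, hπe, hπ⟩ := exists_nat_position hK.mem_values e
    rw [hmap π hπ] at hK₀
    simp only [RawConf.map, Prod.mk.injEq] at hK₀
    obtain ⟨rfl, rfl, rfl, rfl⟩ := hK₀
    obtain ⟨p₀, hp₀, rfl⟩ := List.mem_map.1 hp
    rw [others_map (hmono π) (fun _ _ => Set.mem_univ _) (Set.mem_univ _)] at hN ⊢
    have : e = (π ∘ (Nat.cast : ℕ → ℚ)) e' := hπe.symm
    simp only [Prod.map_fst, Prod.map_snd, id, this] at hN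
    rw [spawn_map (hmono π) (Set.mem_univ _) (Set.mem_univ _)] at hN
    obtain ⟨N₀, hN₀, rfl⟩ := List.mem_map.1 hN
    refine ⟨(α, a, d, N₀ ++ others T p₀), List.mem_append_left _ (mem_epsSuccs.2
      ⟨p₀, hp₀, e', Nat.lt_succ_of_le he', N₀, hN₀, rfl⟩), ?_⟩
    rw [← List.map_append]
    exact hle π (α, a, d, N₀ ++ others T p₀)
  | @move a₀ d₀ T₀ α' a' d' hT hα ha =>
    obtain ⟨e', he', π, hπe, hπ⟩ := exists_nat_position hK.mem_values d'
    rw [hmap π hπ] at hK₀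
    simp only [RawConf.map, Prod.mk.injEq] at hK₀
    obtain ⟨rfl, rfl, rfl, rfl⟩ := hK₀
    refine ⟨(α', a', e', advance c T), List.mem_append_right _ (mem_moveSuccs.2
      ⟨⟨rfl, fun p hp => hT _ (List.mem_map_of_mem hp)⟩, α', hα, a', ha, e',
        Nat.lt_succ_of_le he', rfl⟩), ?_⟩
    rw [advance_map, ← hπe]
    exact hle π (α', a', e', advance c T)

theorem EmptinessCert.not_rawNonempty {c : ARACode} {b : ℕ} {S : List (RawConf ℕ)}
    {M : List (List (ℕ × ℕ))} (h : EmptinessCert c b S M) : ¬ RawNonempty c ℚ := by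
  rintro ⟨α, hα, a, ha, d, K, hK, hT⟩
  obtain ⟨hS, hcov⟩ := h
  have hcov' : ∀ K₁ ∈ inits c (b + 1) ++ S.flatMap (succs c (b + 1)), ∀ K' : RawConf ℚ,
      RawLE (K₁.map (Nat.cast : ℕ → ℚ)) K' → ∃ K ∈ S, RawLE (K.map (Nat.cast : ℕ → ℚ)) K' := by
    intro K₁ h₁ K' hle
    obtain ⟨K, hK, x, -, hx⟩ := hcov K₁ h₁
    exact ⟨K, hK, hx.rawLE.trans hle⟩
  -- The invariant: every reachable configuration lies above a member of `S`. Since members of `S`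
  -- have threads, none is accepting.
  obtain ⟨K₀, hK₀, π, -, -, -, hsub⟩ : ∃ K₀ ∈ S, RawLE (K₀.map (Nat.cast : ℕ → ℚ)) K := by
    clear hT
    induction hK with
    | refl =>
      obtain ⟨e', he', π, hπe, -⟩ := exists_nat_position (b := b) (V := ∅) (by simp) d
      refine hcov' (rawInit c α a e') (List.mem_append_left _ (List.mem_map.2
        ⟨(α, a, e'), mem_labels.2 ⟨hα, ha, Nat.lt_succ_of_le he'⟩, rfl⟩)) _ ⟨π, ?_⟩
      simp [RawSub, RawConf.map, rawInit, hπe]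
    | tail _ hs ih =>
      obtain ⟨K₀, h₀, hle⟩ := ih
      rcases hle.step hs with h | ⟨K₂, h₂, hle₂⟩
      · exact ⟨K₀, h₀, h⟩
      · obtain ⟨K₁, h₁, hle₁⟩ := exists_mem_succs_rawLE (hS K₀ h₀).2 h₂
        exact hcov' K₁ (List.mem_append_right _ (List.mem_flatMap.2 ⟨K₀, h₀, h₁⟩)) _
          (hle₁.trans hle₂)
  refine (hS K₀ hK₀).1 ?_
  rw [hT] at hsub
  simpa [RawConf.map] using List.subset_nil.1 hsub

/-- Every configuration over `ℚ` is isomorphic to one with odd natural numbers as data. -/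
theorem exists_odd_copy (K : RawConf ℚ) : ∃ (K' : RawConf ℕ) (π : ℚ ≃o ℚ),
    K'.map (Nat.cast : ℕ → ℚ) = K.map π ∧ ∃ b₀, ∀ b ≥ b₀, OddBelow b K' := by
  obtain ⟨f, hf⟩ := exists_strictMonoOn_finset (E := ℕ) K.values
  -- Doubling and adding one keeps the order and makes all values odd, which leaves an even number
  -- in every gap.
  obtain ⟨π, hπ⟩ := exists_orderIso_extending
    (K.values.image fun v => (v, ((2 * f v + 1 : ℕ) : ℚ))) (by
      intro p hp q hq
      obtain ⟨v, hv, rfl⟩ := Finset.mem_image.1 hp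
      obtain ⟨w, hw, rfl⟩ := Finset.mem_image.1 hq
      have := hf.lt_iff_lt hv hw
      rw [Nat.cast_lt, ← this]
      omega)
  have hπ' : ∀ v ∈ K.values, ((2 * f v + 1 : ℕ) : ℚ) = π v := fun v hv =>
    (hπ _ (Finset.mem_image_of_mem _ hv)).symm
  refine ⟨K.map fun v => 2 * f v + 1, π, ?_, (K.values.sup fun v => 2 * f v + 2), ?_⟩
  · rw [RawConf.map_map]
    exact RawConf.map_congr (hπ' _ K.datum_mem_values)
      fun p hp => hπ' _ (RawConf.snd_mem_values hp)
  · intro b hb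
    have hb' : ∀ v ∈ K.values, (2 * f v + 1) % 2 = 1 ∧ 2 * f v + 1 < b := by
      intro v hv
      have := (Finset.le_sup (f := fun v => 2 * f v + 2) hv).trans hb
      omega
    refine ⟨hb' _ K.datum_mem_values, fun p hp => ?_⟩
    obtain ⟨q, hq, rfl⟩ := List.mem_map.1 hp
    exact hb' _ (RawConf.snd_mem_values hq)

/-- The certificate is a finite basis of the reachable configurations, copied to odd naturals. A
genuine automaton is needed to bound letters and states, as the well-quasi-order requires. -/
theorem exists_emptinessCert {n m : ℕ} (𝒜 : ARA (Fin n) (Fin m))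
    (h : ¬ RawNonempty 𝒜.code ℚ) : ∃ b S M, EmptinessCert 𝒜.code b S M := by
  classical
  let R : Set (RawConf ℚ) := {K | ∃ α < 2, ∃ a < 𝒜.code.1, ∃ d : ℚ,
    ReflTransGen (RStep 𝒜.code) (rawInit 𝒜.code α a d) K}
  have hR : R ⊆ {K | K.Bounded n m} := by
    rintro K ⟨α, hα, a, ha, d, hK⟩
    obtain ⟨t, C, -, h₁, h₂, -, h₄⟩ := exists_represents_of_run 𝒜 hα ha hK
    refine ⟨?_, ?_, ?_⟩
    · rw [h₁]
      cases C.type <;> decide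
    · rw [h₂]
      exact C.label.1.isLt
    · intro p hp
      obtain ⟨t, -, rfl⟩ := (h₄ p).1 hp
      exact t.1.isLt
  have hRstep : ∀ K ∈ R, ∀ K', RStep 𝒜.code K K' → K' ∈ R := by
    rintro K ⟨α, hα, a, ha, d, hK⟩ K' hs
    exact ⟨α, hα, a, ha, d, hK.tail hs⟩
  have hRmap : ∀ K ∈ R, ∀ π : ℚ ≃o ℚ, K.map π ∈ R := by
    rintro K ⟨α, hα, a, ha, d, hK⟩ π
    obtain ⟨V, hV⟩ := exists_map_reflTransGen (E := ℚ) hK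
    exact ⟨α, hα, a, ha, π d, hV π (π.strictMono.strictMonoOn _)⟩
  -- `R` is closed under steps and automorphisms, so the odd copies of `B` and all their successors
  -- stay in `R` and lie above members of `B`.
  obtain ⟨B, hBR, hB⟩ := exists_finset_basis ((partiallyWellOrderedOn_rawLE n m).mono hR)
  choose g σ hg bd hbd using exists_odd_copy
  have hgR : ∀ K ∈ B, (g K).map (Nat.cast : ℕ → ℚ) ∈ R := fun K hK => by
    rw [hg]
    exact hRmap K (hBR hK) _
  let b := B.sup bd
  let S := B.toList.map g
  have hSR : ∀ K ∈ S, K.map (Nat.cast : ℕ → ℚ) ∈ R := by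
    intro K hK
    obtain ⟨K₀, hK₀, rfl⟩ := List.mem_map.1 hK
    exact hgR K₀ (Finset.mem_toList.1 hK₀)
  have hcov : ∀ K' ∈ inits 𝒜.code (b + 1) ++ S.flatMap (succs 𝒜.code (b + 1)),
      ∃ x, ∃ K ∈ S, Embeds x K K' := by
    intro K' hK'
    have hK'R : K'.map (Nat.cast : ℕ → ℚ) ∈ R := by
      rcases List.mem_append.1 hK' with hK' | hK'
      · obtain ⟨l, hl, rfl⟩ := List.mem_map.1 hK'
        obtain ⟨hα, ha, -⟩ := mem_labels.1 hl
        exact ⟨_, hα, _, ha, (l.2.2 : ℚ), .refl⟩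
      · obtain ⟨K, hK, hs⟩ := List.mem_flatMap.1 hK'
        exact hRstep _ (hSR K hK) _ ((rStep_of_mem_succs hs).map natCast_rat_strictMono)
    obtain ⟨K, hK, hle⟩ := hB _ hK'R
    have hle' : RawLE ((g K).map (Nat.cast : ℕ → ℚ)) K := by
      refine ⟨(σ K).symm, ?_⟩
      have : ((σ K).symm : ℚ → ℚ) ∘ σ K = id := by ext; simp
      rw [hg, RawConf.map_map, this, RawConf.map_id]
      exact ⟨rfl, rfl, rfl, fun _ => id⟩
    obtain ⟨x, hx⟩ := exists_embeds (hle'.trans hle)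
    exact ⟨x, g K, List.mem_map_of_mem (Finset.mem_toList.2 hK), hx⟩
  choose! X hX using hcov
  -- One matching is recorded for each configuration to be covered, so checking the certificate
  -- involves only bounded quantifiers.
  refine ⟨b, S, (inits 𝒜.code (b + 1) ++ S.flatMap (succs 𝒜.code (b + 1))).map X, ?_, ?_⟩
  · intro K hK
    constructor
    · intro hT
      obtain ⟨α, hα, a, ha, d, hK⟩ := hSR K hK
      exact h ⟨α, hα, a, ha, d, _, hK, by simp [RawConf.map, hT]⟩
    · obtain ⟨K₀, hK₀, rfl⟩ := List.mem_map.1 hK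
      exact hbd K₀ b (Finset.le_sup (Finset.mem_toList.1 hK₀))
  · intro K' hK'
    obtain ⟨K, hK, hx⟩ := hX K' hK'
    exact ⟨K, hK, X K', List.mem_map_of_mem hK', hx⟩

/-! ### Primitive recursiveness of the enumeration and of the certificate check -/

section Primrec

variable {γ β : Type*} [Primcodable γ] [Primcodable β]

theorem primrecPred_forall_mem {f : γ → List β} {R : γ → β → Prop} (hf : Primrec f)
    (hR : PrimrecPred fun x : γ × β => R x.1 x.2) : PrimrecPred fun a => ∀ b ∈ f a, R a b :=
  (PrimrecRel.forall_mem_list (R := fun b a => R a b) (hR.comp (pair snd fst))).comp hf .id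

theorem primrecPred_exists_mem {f : γ → List β} {R : γ → β → Prop} (hf : Primrec f)
    (hR : PrimrecPred fun x : γ × β => R x.1 x.2) : PrimrecPred fun a => ∃ b ∈ f a, R a b :=
  (PrimrecRel.exists_mem_list (R := fun b a => R a b) (hR.comp (pair snd fst))).comp hf .id

theorem primrec_filter {f : γ → List β} {R : γ → β → Prop} [∀ a, DecidablePred (R a)]
    (hf : Primrec f) (hR : PrimrecPred fun x : γ × β => R x.1 x.2) :
    Primrec fun a => (f a).filter fun b => R a b := by
  have : DecidableRel fun (b : β) (a : γ) => R a b := fun b a => inferInstance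
  have h := (PrimrecRel.listFilter (R := fun b a => R a b) (hR.comp (pair snd fst))).comp hf .id
  exact h.of_eq fun a => List.filter_congr fun b _ => by simp

theorem primrecPred_mem {f : γ → List β} {g : γ → β} (hf : Primrec f) (hg : Primrec g) :
    PrimrecPred fun a => g a ∈ f a :=
  (primrecPred_exists_mem (R := fun a b => b = g a) hf
    (Primrec.eq.comp snd (hg.comp fst))).of_eq fun a => by simp

/-- Unbounded search through the codes of possible witnesses halts exactly when a witness exists. -/
theorem rePred_exists {p : γ → β → Prop} (hp : PrimrecPred fun x : γ × β => p x.1 x.2) :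
    REPred fun a => ∃ b, p a b := by
  classical
  let f : γ → ℕ → Option Unit := fun a n =>
    (Encodable.decode (α := β) n).bind fun b => if p a b then some () else none
  have hf : Primrec₂ f := by
    refine Primrec.option_bind (Primrec.decode.comp snd) ?_
    exact Primrec.ite (hp.comp (pair (fst.comp fst) snd)) (const _) (const _)
  refine (Partrec.dom_re (Partrec.rfindOpt hf.to_comp)).of_eq fun a => ?_
  rw [Nat.rfindOpt_dom]
  constructor
  · rintro ⟨n, u, h⟩
    obtain ⟨b, -, hb⟩ := Option.bind_eq_some_iff.1 h
    by_contra hne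
    rw [if_neg fun h => hne ⟨b, h⟩] at hb
    cases hb
  · rintro ⟨b, hb⟩
    exact ⟨Encodable.encode b, (), by simp [f, hb]⟩

theorem primrec_instr {fc : γ → ARACode} {fq : γ → ℕ} (hc : Primrec fc) (hq : Primrec fq) :
    Primrec fun x => (fc x).instr (fq x) :=
  (Primrec.list_getD (0, 0, 0)).comp (snd.comp (snd.comp (snd.comp hc))) hq

theorem primrecPred_eq_nat {f : γ → ℕ} (hf : Primrec f) (k : ℕ) : PrimrecPred fun x => f x = k :=
  Primrec.eq.comp hf (const k)

theorem primrecPred_rawTest {fx fd fv : γ → ℕ} (hx : Primrec fx) (hd : Primrec fd)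
    (hv : Primrec fv) : PrimrecPred fun x => RawTest (fx x) (fd x) (fv x) :=
  ((primrecPred_eq_nat hx 0).and (nat_lt.comp hd hv)).or <|
  ((primrecPred_eq_nat hx 1).and (nat_lt.comp hv hd)).or <|
  ((primrecPred_eq_nat hx 2).and (Primrec.eq.comp hd hv)).or <|
  (primrecPred_eq_nat hx 3).and (Primrec.eq.comp hd hv).not

theorem primrec_singleton {f : γ → β} (hf : Primrec f) : Primrec fun x => [f x] :=
  list_cons.comp hf (const [])

theorem primrec_spawn {fc : γ → ARACode} {fα fa fd fv fe : γ → ℕ} {fE : γ → List (ℕ × ℕ)}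
    {fi : γ → ℕ × ℕ × ℕ} (hc : Primrec fc) (hα : Primrec fα) (ha : Primrec fa) (hd : Primrec fd)
    (hv : Primrec fv) (he : Primrec fe) (hE : Primrec fE) (hi : Primrec fi) :
    Primrec fun x => spawn (fc x) (fα x) (fa x) (fd x) (fv x) (fe x) (fE x) (fi x) := by
  have h1 : Primrec fun x => (fi x).1 := fst.comp hi
  have h2 : Primrec fun x => (fi x).2.1 := fst.comp (snd.comp hi)
  have h3 : Primrec fun x => (fi x).2.2 := snd.comp (snd.comp hi)
  unfold spawn
  refine Primrec.ite ?_ (const _) <| Primrec.ite (primrecPred_eq_nat h1 _) ?_ <|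
    Primrec.ite (primrecPred_eq_nat h1 _) ?_ <| Primrec.ite (primrecPred_eq_nat h1 _) ?_ <|
    Primrec.ite (primrecPred_eq_nat h1 _) ?_ <| Primrec.ite ?_ ?_ (const _)
  · exact ((primrecPred_eq_nat h1 0).and (Primrec.eq.comp h2 ha)).or <|
      ((primrecPred_eq_nat h1 1).and (Primrec.eq.comp h2 ha).not).or <|
      ((primrecPred_eq_nat h1 2).and (Primrec.eq.comp h2 hα)).or <|
      (primrecPred_eq_nat h1 4).and (primrecPred_rawTest h2 hd hv)
  · exact primrec_singleton (primrec_singleton (pair h2 hd))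
  · exact primrec_singleton (list_cons.comp (pair h2 hv) (primrec_singleton (pair h3 hv)))
  · exact list_cons.comp (primrec_singleton (pair h2 hv))
      (primrec_singleton (primrec_singleton (pair h3 hv)))
  · exact primrec_singleton (primrec_singleton (pair h2 he))
  · refine (primrecPred_eq_nat h1 9).and (primrecPred_forall_mem hE ?_)
    have := fst.comp (primrec_instr (hc.comp fst) (fst.comp (snd (α := γ) (β := ℕ × ℕ))))
    exact (primrecPred_eq_nat this 9).or (primrecPred_eq_nat this 7)
  · refine primrec_singleton (list_map (primrec_filter hE ?_) ?_)
    · exact Primrec.eq.comp (fst.comp snd) (h2.comp fst)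
    · exact pair (h3.comp fst) (snd.comp snd)

theorem primrec_others {fT : γ → List (ℕ × ℕ)} {fp : γ → ℕ × ℕ} (hT : Primrec fT)
    (hp : Primrec fp) : Primrec fun x => others (fT x) (fp x) :=
  primrec_filter hT (Primrec.eq.comp snd (hp.comp fst)).not

theorem primrec_advance {fc : γ → ARACode} {fT : γ → List (ℕ × ℕ)} (hc : Primrec fc)
    (hT : Primrec fT) : Primrec fun x => advance (fc x) (fT x) := by
  refine list_map hT (pair ?_ (snd.comp snd))
  exact fst.comp (snd.comp (primrec_instr (hc.comp fst) (fst.comp snd)))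

theorem primrec_labels {fc : γ → ARACode} {fb : γ → ℕ} (hc : Primrec fc) (hb : Primrec fb) :
    Primrec fun x => labels (fc x) (fb x) := by
  refine list_flatMap (const _) (list_flatMap (list_range.comp (fst.comp (hc.comp fst))) ?_)
  exact list_map (list_range.comp (hb.comp (fst.comp fst)))
    (pair (snd.comp (fst.comp fst)) (pair (snd.comp fst) snd))

theorem primrec_inits {fc : γ → ARACode} {fb : γ → ℕ} (hc : Primrec fc) (hb : Primrec fb) :
    Primrec fun x => inits (fc x) (fb x) := by
  have hd : Primrec fun x : γ × (ℕ × ℕ × ℕ) => x.2.2.2 := snd.comp (snd.comp snd)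
  have hq : Primrec fun x : γ × (ℕ × ℕ × ℕ) => (fc x.1).2.2.1 :=
    fst.comp (snd.comp (snd.comp (hc.comp fst)))
  exact list_map (primrec_labels hc hb) (pair (fst.comp snd) (pair (fst.comp (snd.comp snd))
    (pair hd (primrec_singleton (pair hq hd)))))

theorem primrec_epsSuccs {fc : γ → ARACode} {fb : γ → ℕ} {fK : γ → RawConf ℕ} (hc : Primrec fc)
    (hb : Primrec fb) (hK : Primrec fK) : Primrec fun x => epsSuccs (fc x) (fb x) (fK x) := by
  have h1 : Primrec fun x => (fK x).1 := fst.comp hK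
  have h2 : Primrec fun x => (fK x).2.1 := fst.comp (snd.comp hK)
  have h3 : Primrec fun x => (fK x).2.2.1 := fst.comp (snd.comp (snd.comp hK))
  have h4 : Primrec fun x => (fK x).2.2.2 := snd.comp (snd.comp (snd.comp hK))
  have ho : Primrec fun x : (γ × (ℕ × ℕ)) => others (fK x.1).2.2.2 x.2 :=
    primrec_others (h4.comp fst) snd
  refine list_flatMap h4 (list_flatMap (list_range.comp (hb.comp fst)) (list_map ?_ ?_))
  · have hx : Primrec fun x : (γ × (ℕ × ℕ)) × ℕ => x.1.1 := fst.comp fst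
    have hp : Primrec fun x : (γ × (ℕ × ℕ)) × ℕ => x.1.2 := snd.comp fst
    exact primrec_spawn (hc.comp hx) (h1.comp hx) (h2.comp hx) (h3.comp hx) (snd.comp hp) snd
      (ho.comp fst) (primrec_instr (hc.comp hx) (fst.comp hp))
  · have hx : Primrec fun x : ((γ × (ℕ × ℕ)) × ℕ) × List (ℕ × ℕ) => x.1.1 := fst.comp fst
    exact pair (h1.comp (fst.comp hx)) (pair (h2.comp (fst.comp hx))
      (pair (h3.comp (fst.comp hx)) (list_append.comp snd (ho.comp hx))))

theorem primrec_moveSuccs {fc : γ → ARACode} {fb : γ → ℕ} {fK : γ → RawConf ℕ} (hc : Primrec fc)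
    (hb : Primrec fb) (hK : Primrec fK) : Primrec fun x => moveSuccs (fc x) (fb x) (fK x) := by
  have h1 : Primrec fun x => (fK x).1 := fst.comp hK
  have h4 : Primrec fun x => (fK x).2.2.2 := snd.comp (snd.comp (snd.comp hK))
  refine Primrec.ite ?_ (list_map (primrec_labels hc hb) ?_) (const _)
  · refine (primrecPred_eq_nat h1 0).and (primrecPred_forall_mem h4 ?_)
    exact primrecPred_eq_nat (fst.comp (primrec_instr (hc.comp fst) (fst.comp snd))) 7
  · exact pair (fst.comp snd) (pair (fst.comp (snd.comp snd)) (pair (snd.comp (snd.comp snd))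
      ((primrec_advance hc h4).comp fst)))

theorem primrec_succs {fc : γ → ARACode} {fb : γ → ℕ} {fK : γ → RawConf ℕ} (hc : Primrec fc)
    (hb : Primrec fb) (hK : Primrec fK) : Primrec fun x => succs (fc x) (fb x) (fK x) :=
  list_append.comp (primrec_epsSuccs hc hb hK) (primrec_moveSuccs hc hb hK)

theorem primrec_reach {fc : γ → ARACode} {fb fk : γ → ℕ} (hc : Primrec fc) (hb : Primrec fb)
    (hk : Primrec fk) : Primrec fun x => reach (fc x) (fb x) (fk x) := by
  refine nat_iterate hk (primrec_inits hc hb) (list_flatMap snd ?_)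
  exact primrec_succs (hc.comp (fst.comp fst)) (hb.comp (fst.comp fst)) snd

theorem primrecPred_odd_lt {f g : γ → ℕ} (hf : Primrec f) (hg : Primrec g) :
    PrimrecPred fun x => f x % 2 = 1 ∧ f x < g x :=
  (primrecPred_eq_nat (nat_mod.comp hf (const 2)) 1).and (nat_lt.comp hf hg)

theorem primrecPred_oddBelow {fb : γ → ℕ} {fK : γ → RawConf ℕ} (hb : Primrec fb)
    (hK : Primrec fK) : PrimrecPred fun x => OddBelow (fb x) (fK x) := by
  have h3 : Primrec fun x => (fK x).2.2.1 := fst.comp (snd.comp (snd.comp hK))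
  have h4 : Primrec fun x => (fK x).2.2.2 := snd.comp (snd.comp (snd.comp hK))
  exact (primrecPred_odd_lt h3 hb).and
    (primrecPred_forall_mem h4 (primrecPred_odd_lt (snd.comp snd) (hb.comp fst)))

theorem primrecPred_iff {p q : γ → Prop} (hp : PrimrecPred p) (hq : PrimrecPred q) :
    PrimrecPred fun x => p x ↔ q x :=
  ((hp.and hq).or (hp.not.and hq.not)).of_eq fun x => by tauto

theorem primrecPred_embeds {fx : γ → List (ℕ × ℕ)} {fK fK' : γ → RawConf ℕ} (hx : Primrec fx)
    (hK : Primrec fK) (hK' : Primrec fK') :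
    PrimrecPred fun x => Embeds (fx x) (fK x) (fK' x) := by
  have h4 : Primrec fun x => (fK x).2.2.2 := snd.comp (snd.comp (snd.comp hK))
  have h4' : Primrec fun x => (fK' x).2.2.2 := snd.comp (snd.comp (snd.comp hK'))
  refine (Primrec.eq.comp (fst.comp hK) (fst.comp hK')).and <|
    (Primrec.eq.comp (fst.comp (snd.comp hK)) (fst.comp (snd.comp hK'))).and <|
    PrimrecPred.and ?_ <| PrimrecPred.and ?_ ?_
  · exact primrecPred_mem hx (pair (fst.comp (snd.comp (snd.comp hK)))
      (fst.comp (snd.comp (snd.comp hK'))))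
  · refine primrecPred_forall_mem h4 (primrecPred_exists_mem (hx.comp fst) ?_)
    have hp : Primrec fun y : (γ × (ℕ × ℕ)) × (ℕ × ℕ) => y.1.2 := snd.comp fst
    exact (Primrec.eq.comp (fst.comp snd) (snd.comp hp)).and
      (primrecPred_mem (h4'.comp (fst.comp fst)) (pair (fst.comp hp) (snd.comp snd)))
  · refine primrecPred_forall_mem hx (primrecPred_forall_mem (hx.comp fst) ?_)
    have hp : Primrec fun y : (γ × (ℕ × ℕ)) × (ℕ × ℕ) => y.1.2 := snd.comp fst
    exact primrecPred_iff (nat_lt.comp (fst.comp hp) (fst.comp snd))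
      (nat_lt.comp (snd.comp hp) (snd.comp snd))

theorem primrecPred_emptinessCert {fc : γ → ARACode} {fb : γ → ℕ} {fS : γ → List (RawConf ℕ)}
    {fM : γ → List (List (ℕ × ℕ))} (hc : Primrec fc) (hb : Primrec fb) (hS : Primrec fS)
    (hM : Primrec fM) : PrimrecPred fun x => EmptinessCert (fc x) (fb x) (fS x) (fM x) := by
  have hb1 : Primrec fun x => fb x + 1 := Primrec.succ.comp hb
  refine PrimrecPred.and ?_ ?_
  · refine primrecPred_forall_mem hS (PrimrecPred.and ?_ (primrecPred_oddBelow (hb.comp fst) snd))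
    exact (Primrec.eq.comp (snd.comp (snd.comp (snd.comp snd))) (const [])).not
  · refine primrecPred_forall_mem (list_append.comp (primrec_inits hc hb1) (list_flatMap hS
      (primrec_succs (hc.comp fst) (hb1.comp fst) snd))) ?_
    refine primrecPred_exists_mem (hS.comp fst) (primrecPred_exists_mem
      (hM.comp (fst.comp fst)) ?_)
    exact primrecPred_embeds snd (snd.comp fst) (snd.comp (fst.comp fst))

end Primrec

/-! ### Recognising codes of automata -/

/-- The triple `i` is the code of an instruction over `n` letters and `m` states. -/
def ValidInstr (n m : ℕ) (i : ℕ × ℕ × ℕ) : Prop :=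
  (i.1 = 0 ∨ i.1 = 1) ∧ i.2.1 < n ∧ i.2.2 = 0 ∨ i.1 = 2 ∧ i.2.1 < 2 ∧ i.2.2 = 0 ∨
  i.1 = 4 ∧ i.2.1 < 4 ∧ i.2.2 = 0 ∨
  (i.1 = 3 ∨ i.1 = 7 ∨ i.1 = 8) ∧ i.2.1 < m ∧ i.2.2 = 0 ∨
  (i.1 = 5 ∨ i.1 = 6 ∨ i.1 = 9) ∧ i.2.1 < m ∧ i.2.2 < m

theorem validInstr_iff {n m : ℕ} {i : ℕ × ℕ × ℕ} :
    ValidInstr n m i ↔ ∃ I : Instr (Fin n) (Fin m), I.code = i := by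
  constructor
  · obtain ⟨t, x, y⟩ := i
    rintro (⟨rfl | rfl, h, rfl⟩ | ⟨rfl, h, rfl⟩ | ⟨rfl, h, rfl⟩ | ⟨rfl | rfl | rfl, h, rfl⟩ |
      ⟨rfl | rfl | rfl, h, h'⟩)
    · exact ⟨.letter ⟨x, h⟩, rfl⟩
    · exact ⟨.notLetter ⟨x, h⟩, rfl⟩
    · dsimp only at h
      interval_cases x
      exacts [⟨.isType .hasNext, rfl⟩, ⟨.isType .isLast, rfl⟩]
    · dsimp only at h
      interval_cases x
      exacts [⟨.test .lt, rfl⟩, ⟨.test .gt, rfl⟩, ⟨.test .eq, rfl⟩, ⟨.test .ne, rfl⟩]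
    · exact ⟨.store ⟨x, h⟩, rfl⟩
    · exact ⟨.move ⟨x, h⟩, rfl⟩
    · exact ⟨.guess ⟨x, h⟩, rfl⟩
    · exact ⟨.and ⟨x, h⟩ ⟨y, h'⟩, rfl⟩
    · exact ⟨.or ⟨x, h⟩ ⟨y, h'⟩, rfl⟩
    · exact ⟨.spread ⟨x, h⟩ ⟨y, h'⟩, rfl⟩
  · rintro ⟨a | a | (_ | _) | q | (_ | _ | _ | _) | ⟨q, q'⟩ | ⟨q, q'⟩ | q | q | ⟨q, q'⟩, rfl⟩ <;>
      simp [ValidInstr, Instr.code, PosType.code, DataTest.code]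

/-- `c` is the code of an automaton. -/
def ARACode.Valid (c : ARACode) : Prop :=
  c.2.2.1 < c.2.1 ∧ c.2.2.2.length = c.2.1 ∧ ∀ i ∈ c.2.2.2, ValidInstr c.1 c.2.1 i

theorem ARACode.valid_iff {c : ARACode} :
    c.Valid ↔ ∃ (n m : ℕ) (𝒜 : ARA (Fin n) (Fin m)), 𝒜.code = c := by
  constructor
  · obtain ⟨n, m, q, l⟩ := c
    rintro ⟨hq, hl, hv⟩
    dsimp only at hq hl hv
    subst hl
    have : ∀ k : Fin l.length, ∃ I : Instr (Fin n) (Fin l.length), I.code = l[k] :=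
      fun k => validInstr_iff.1 (hv _ (List.getElem_mem _))
    choose δ hδ using this
    refine ⟨n, _, ⟨⟨q, hq⟩, δ⟩, ?_⟩
    simp [ARA.code, hδ]
  · rintro ⟨n, m, 𝒜, rfl⟩
    refine ⟨𝒜.init.isLt, by simp [ARA.code], fun i hi => ?_⟩
    obtain ⟨q, rfl⟩ := List.mem_ofFn.1 hi
    exact validInstr_iff.2 ⟨_, rfl⟩

theorem primrecPred_valid : PrimrecPred ARACode.Valid := by
  have hn : Primrec fun c : ARACode => c.1 := fst
  have hm : Primrec fun c : ARACode => c.2.1 := fst.comp snd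
  have hl : Primrec fun c : ARACode => c.2.2.2 := snd.comp (snd.comp snd)
  refine (nat_lt.comp (fst.comp (snd.comp snd)) hm).and <|
    (Primrec.eq.comp (list_length.comp hl) hm).and (primrecPred_forall_mem hl ?_)
  have h1 : Primrec fun x : ARACode × (ℕ × ℕ × ℕ) => x.2.1 := fst.comp snd
  have h2 : Primrec fun x : ARACode × (ℕ × ℕ × ℕ) => x.2.2.1 := fst.comp (snd.comp snd)
  have h3 : Primrec fun x : ARACode × (ℕ × ℕ × ℕ) => x.2.2.2 := snd.comp (snd.comp snd)
  have h30 := primrecPred_eq_nat h3 0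
  have e := primrecPred_eq_nat h1
  have hm' : Primrec fun x : ARACode × (ℕ × ℕ × ℕ) => x.1.2.1 := hm.comp fst
  exact (((e 0).or (e 1)).and ((nat_lt.comp h2 (hn.comp fst)).and h30)).or <|
    ((e 2).and ((nat_lt.comp h2 (const 2)).and h30)).or <|
    ((e 4).and ((nat_lt.comp h2 (const 4)).and h30)).or <|
    (((e 3).or ((e 7).or (e 8))).and ((nat_lt.comp h2 hm').and h30)).or <|
    ((e 5).or ((e 6).or (e 9))).and ((nat_lt.comp h2 hm').and (nat_lt.comp h3 hm'))

/-! ### Decidability -/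

theorem exists_language_eq_empty_iff (D : Type*) [LinearOrder D] [Infinite D] (c : ARACode) :
    (∃ (n m : ℕ) (𝒜 : ARA (Fin n) (Fin m)), 𝒜.code = c ∧ 𝒜.language D = ∅) ↔
      c.Valid ∧ ¬ RawNonempty c ℕ := by
  have hD : RawNonempty c ℕ ↔ RawNonempty c D := ⟨fun h => h.transfer D, fun h => h.transfer ℕ⟩
  rw [ARACode.valid_iff, hD]
  constructor
  · rintro ⟨n, m, 𝒜, rfl, h⟩
    exact ⟨⟨n, m, 𝒜, rfl⟩, (language_eq_empty_iff 𝒜).1 h⟩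
  · rintro ⟨⟨n, m, 𝒜, rfl⟩, h⟩
    exact ⟨n, m, 𝒜, rfl, (language_eq_empty_iff 𝒜).2 h⟩

theorem not_rawNonempty_iff_exists_cert {c : ARACode} (hc : c.Valid) :
    ¬ RawNonempty c ℕ ↔ ∃ x : ℕ × List (RawConf ℕ) × List (List (ℕ × ℕ)),
      EmptinessCert c x.1 x.2.1 x.2.2 := by
  have hQ : RawNonempty c ℕ ↔ RawNonempty c ℚ := ⟨fun h => h.transfer ℚ, fun h => h.transfer ℕ⟩
  rw [hQ]
  constructor
  · intro h
    obtain ⟨n, m, 𝒜, rfl⟩ := ARACode.valid_iff.1 hc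
    obtain ⟨b, S, M, h⟩ := exists_emptinessCert 𝒜 h
    exact ⟨(b, S, M), h⟩
  · rintro ⟨x, h⟩
    exact h.not_rawNonempty

end AltReg

open AltReg in
theorem mainTheorem5 (D : Type*) [LinearOrder D] [Infinite D] :
    ComputablePred fun c : AltReg.ARACode =>
      ∃ (n m : ℕ) (𝒜 : AltReg.ARA (Fin n) (Fin m)), 𝒜.code = c ∧ 𝒜.language D = ∅ := by
  refine ComputablePred.of_eq (p := fun c : ARACode => c.Valid ∧ ¬ RawNonempty c ℕ) ?_
    fun c => (exists_language_eq_empty_iff D c).symm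
  -- Post's theorem: certificates enumerate the empty automata; invalid codes and accepting runs
  -- over `ℕ` enumerate the complement.
  rw [ComputablePred.computable_iff_re_compl_re']
  constructor
  · refine (rePred_exists (p := fun (c : ARACode)
      (x : ℕ × List (RawConf ℕ) × List (List (ℕ × ℕ))) =>
        c.Valid ∧ EmptinessCert c x.1 x.2.1 x.2.2) ?_).of_eq fun c => ?_
    · exact (primrecPred_valid.comp .fst).and (primrecPred_emptinessCert .fst
        (Primrec.fst.comp .snd) (Primrec.fst.comp (Primrec.snd.comp .snd))
        (Primrec.snd.comp (Primrec.snd.comp .snd)))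
    · rw [exists_and_left]
      exact and_congr_right fun hc => (not_rawNonempty_iff_exists_cert hc).symm
  · refine (rePred_exists (p := fun (c : ARACode) (x : ℕ × ℕ) =>
      ¬ c.Valid ∨ ∃ K ∈ reach c x.1 x.2, K.2.2.2 = []) ?_).of_eq fun c => ?_
    · refine (primrecPred_valid.comp .fst).not.or (primrecPred_exists_mem
        (primrec_reach .fst (Primrec.fst.comp .snd) (Primrec.snd.comp .snd)) ?_)
      exact Primrec.eq.comp
        (Primrec.snd.comp (Primrec.snd.comp (Primrec.snd.comp .snd))) (.const [])
    · rw [exists_or, exists_const, Prod.exists, not_and_or, not_not,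
        rawNonempty_iff_exists_reach]
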